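/- Let $d\ge 0$ and $N\ge 1$ be integers and let $\kappa\ge 0$. Let $\mathbf U(d)$ be the group of unitary $d\times d$ matrices, let $\mathfrak{su}(d)$ denote here the real vector space of all skew-Hermitian matrices in $M_d(\mathbb C)$ (no trace condition), put $E=\mathbf U(d)\times\mathfrak{su}(d)$, $\|M\|_2^2=\operatorname{trace}(M^*M)$ and $K(U,V)=UV^*-VU^*$. For Borel probability measures $\mu,\nu$ on $E$ let $$\operatorname{dist}_{MK,2}(\mu,\nu)^2=\inf_m\int_{E\times E}\big(\|U-V\|_2^2+\|A-B\|_2^2\big)\,m(dU\,dA\,dV\,dB),$$ where $m$ runs over the couplings of $\mu$ and $\nu$. Let $f^0$ be a Borel probability measure on $E$ with finite second moment. Let $f:[0,\infty)\to\mathcal P(E)$ be a weakly continuous curve of probability measures that is a weak solution, with $f(0)=f^0$, of the kinetic Lohe equation $$\partial_t f+\operatorname{div}_U(fAU)+\frac{\kappa}{2}\operatorname{div}_U\Big(f\int_{\mathbf U(d)}K(V,U)U\,\rho_f(t,dV)\Big)=0,$$ where $\rho_f(t)$ is the push-forward of $f(t)$ by $(U,A)\mapsto U$. Let $F_N:[0,\infty)\to\mathcal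 P(E^N)$ be a weakly continuous weak solution, with $F_N(0)=(f^0)^{\otimes N}$, of the Liouville equation $$\partial_t F_N+\sum_{j=1}^N\operatorname{div}_{U_j}(F_NA_jU_j)+\frac{\kappa}{2N}\sum_{j=1}^N\operatorname{div}_{U_j}\Big(F_N\sum_{k=1}^NK(U_k,U_j)U_j\Big)=0.$$ (A weakly continuous curve $\mu$ is a weak solution of $\partial_t\mu+\operatorname{div}(\mu\, b)=0$ with $\mu(0)=\mu^0$ if $\int\phi\,d\mu(t)=\int\phi\,d\mu^0+\int_0^t\int (d\phi,b(s,\cdot))\,d\mu(s)\,ds$ for all $t\ge 0$ and all compactly supported $C^1$ functions $\phi$.) Let $F_{N:1}(t)$ be the first marginal of $F_N(t)$, i.e. its push-forward by $(U_1,A_1,\dots,U_N,A_N)\mapsto(U_1,A_1)$. Then, for all $t\ge 0$, $$\operatorname{dist}_{MK,2}(f(t),F_{N:1}(t))^2\le\frac{16\,\kappa\, d}{(2+9\kappa)N}\Big(e^{(1+\frac{9\kappa}{2})t}-1\Big).$$ In particular, if $\kappa\le 2$, then $$\operatorname{dist}_{MK,2}(f(t),F_{N:1}(t))^2\le\frac{8d}{5N}\big(e^{10t}-1\big)\qquad\text{for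 all }t\ge 0.$$ (The two right-hand sides coincide for $\kappa=2$.) -/

import Mathlib

open MeasureTheory
open scoped ENNReal Matrix

noncomputable section

namespace Lohe

/-- `M_d(ℂ)`. -/
abbrev Mat (d : ℕ) : Type := Matrix (Fin d) (Fin d) ℂ

/-- The Borel σ-algebra on `M_d(ℂ)`, as the product σ-algebra over the entries. -/
instance instMeasurableSpaceMat (d : ℕ) : MeasurableSpace (Mat d) :=
  inferInstanceAs (MeasurableSpace (Fin d → Fin d → ℂ))

instance instBorelSpaceMat (d : ℕ) : BorelSpace (Mat d) :=
  inferInstanceAs (BorelSpace (Fin d → Fin d → ℂ))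

instance instSecondCountableTopologyMat (d : ℕ) : SecondCountableTopology (Mat d) :=
  inferInstanceAs (SecondCountableTopology (Fin d → Fin d → ℂ))

instance instSecondCountableTopologyUnitary (d : ℕ) :
    SecondCountableTopology (Matrix.unitaryGroup (Fin d) ℂ) :=
  TopologicalSpace.Subtype.secondCountableTopology _

instance instSecondCountableTopologySkew (d : ℕ) :
    SecondCountableTopology (skewAdjoint (Mat d)) :=
  TopologicalSpace.Subtype.secondCountableTopology _

/-- The single-oscillator phase space: pairs `(U, A)` with `U` unitary and `A` skew-Hermitian,
`A = -iH` with `H` Hermitian (no condition on the trace). -/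
abbrev Phase (d : ℕ) : Type := Matrix.unitaryGroup (Fin d) ℂ × skewAdjoint (Mat d)

/-- The real vector space `M_d(ℂ) × M_d(ℂ)` in which `Phase d` is a closed submanifold,
written with coordinates so that it carries its usual normed structure. -/
abbrev Ambient (d : ℕ) : Type := (Fin d → Fin d → ℂ) × (Fin d → Fin d → ℂ)

/-- The inclusion of the phase space in the ambient vector space. -/
def toAmbient {d : ℕ} (z : Phase d) : Ambient d :=
  (fun i j => (z.1 : Mat d) i j, fun i j => (z.2 : Mat d) i j)

/-- The vector `(X, 0)`: a velocity in the variable `U` only. -/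
def inU {d : ℕ} (X : Mat d) : Ambient d := (fun i j => X i j, 0)

/-- The synchronization coupling `K(U, V) = U V* - V U*`. -/
def K {d : ℕ} (U V : Mat d) : Mat d := U * Vᴴ - V * Uᴴ

/-- Weak solutions on `[0, ∞)` of `∂ₜ μ + div (μ b) = 0` with initial datum `μ₀`, for
Borel probability measures on a space `X` embedded by `ι` as a closed submanifold of the vector
space `E`; `b t x` is the velocity at time `t` and point `x`, a vector tangent to `X`.
The curve `μ` is continuous for the weak topology of probability measures, and the test functions
are the compactly supported `C¹` functions on `X`, that is, the restrictions to `X` of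
compactly supported `C¹` functions on `E`. -/
structure IsWeakSolution {X E : Type} [TopologicalSpace X] [MeasurableSpace X]
    [OpensMeasurableSpace X] [NormedAddCommGroup E] [NormedSpace ℝ E]
    (ι : X → E) (b : ℝ → X → E) (μ₀ : ProbabilityMeasure X) (μ : ℝ → ProbabilityMeasure X) :
    Prop where
  continuousOn : ContinuousOn μ (Set.Ici 0)
  initial : μ 0 = μ₀
  weak : ∀ φ : E → ℝ, ContDiff ℝ 1 φ → HasCompactSupport φ → ∀ t : ℝ, 0 ≤ t →
    ∫ x, φ (ι x) ∂(μ t : Measure X) = ∫ x, φ (ι x) ∂(μ₀ : Measure X) +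
      ∫ s in (0 : ℝ)..t, ∫ x, fderiv ℝ φ (ι x) (b s x) ∂(μ s : Measure X)

/-- `∫ K(V, U) ρ_m(dV)`, integrated entrywise, where `ρ_m` is the push-forward of the
measure `m` by `(V, B) ↦ V`. -/
def meanK {d : ℕ} (m : ProbabilityMeasure (Phase d)) (U : Mat d) : Mat d :=
  Matrix.of fun i j =>
    ∫ V : Matrix.unitaryGroup (Fin d) ℂ, K (V : Mat d) U i j ∂((m : Measure (Phase d)).map Prod.fst)

/-- The vector field `(U, A) ↦ (A + (κ/2) ∫ K(V, U) ρ_m(dV)) U` of the kinetic Lohe equation. -/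
def kineticField {d : ℕ} (κ : ℝ) (m : ProbabilityMeasure (Phase d)) (z : Phase d) : Ambient d :=
  inU (((z.2 : Mat d) + ((κ / 2 : ℝ) : ℂ) • meanK m (z.1 : Mat d)) * (z.1 : Mat d))

/-- Weak solutions of the kinetic Lohe equation
`∂ₜ f + div_U (f A U) + (κ/2) div_U (f ∫ K(V, U) U ρ_f(t, dV)) = 0`, `f(0) = f₀`. -/
def IsKineticLoheSolution {d : ℕ} (κ : ℝ) (f₀ : ProbabilityMeasure (Phase d))
    (f : ℝ → ProbabilityMeasure (Phase d)) : Prop :=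
  IsWeakSolution toAmbient (fun t => kineticField κ (f t)) f₀ f

/-- The vector field of the Lohe matrix model with `N` oscillators: its `j`-th component is
`(A_j + κ/(2N) ∑_k K(U_k, U_j)) U_j`. -/
def loheField {d N : ℕ} (κ : ℝ) (z : Fin N → Phase d) : Fin N → Ambient d := fun j =>
  inU ((((z j).2 : Mat d) +
    ((κ / (2 * (N : ℝ)) : ℝ) : ℂ) • ∑ k : Fin N, K ((z k).1 : Mat d) ((z j).1 : Mat d)) *
      ((z j).1 : Mat d))

/-- Weak solutions of the `N`-oscillator Liouville equation
`∂ₜ F + ∑_j div_{U_j} (F A_j U_j) + κ/(2N) ∑_j div_{U_j} (F ∑_k K(U_k, U_j) U_j) = 0`,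
`F(0) = F₀`. -/
def IsLiouvilleSolution {d N : ℕ} (κ : ℝ) (F₀ : ProbabilityMeasure (Fin N → Phase d))
    (F : ℝ → ProbabilityMeasure (Fin N → Phase d)) : Prop :=
  IsWeakSolution (fun z j => toAmbient (z j)) (fun _ => loheField κ) F₀ F

/-- The squared Frobenius norm `‖M‖₂² = trace (M* M)`. -/
def frobSq {d : ℕ} (M : Mat d) : ℝ := ∑ i, ∑ j, ‖M i j‖ ^ 2

/-- `‖U - V‖₂² + ‖A - B‖₂²` for `z = (U, A)` and `w = (V, B)`. -/
def distSq {d : ℕ} (z w : Phase d) : ℝ :=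
  frobSq ((z.1 : Mat d) - (w.1 : Mat d)) + frobSq ((z.2 : Mat d) - (w.2 : Mat d))

/-- `μ` has a finite moment of order two. -/
def HasFiniteSecondMoment {d : ℕ} (μ : ProbabilityMeasure (Phase d)) : Prop :=
  ∃ z₀ : Phase d, ∫⁻ z, ENNReal.ofReal (distSq z₀ z) ∂(μ : Measure (Phase d)) < ∞

/-- Couplings of two measures. -/
def couplings {X : Type} [MeasurableSpace X] (μ ν : Measure X) : Set (Measure (X × X)) :=
  {m | m.map Prod.fst = μ ∧ m.map Prod.snd = ν}

/-- The Monge-Kantorovich (Wasserstein) distance of exponent two. -/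
def distMK2 {d : ℕ} (μ ν : Measure (Phase d)) : ℝ≥0∞ :=
  (⨅ m ∈ couplings μ ν, ∫⁻ p, ENNReal.ofReal (distSq p.1 p.2) ∂m) ^ (1 / 2 : ℝ)

/-- The first marginal `F_{N:1}` of a measure on the `N`-oscillator phase space, `N ≥ 1`. -/
def firstMarginal {d N : ℕ} (hN : 0 < N) (F : ProbabilityMeasure (Fin N → Phase d)) :
    Measure (Phase d) :=
  (F : Measure (Fin N → Phase d)).map (fun z => z ⟨0, hN⟩)

end Lohe

end

/-!
The estimate is proved by coupling. Draw `z = (z_1, …, z_N)` from `f₀^{⊗N}`. Let `(U_j, A_j)` follow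
the `N`-oscillator system from `z`, and let `(V_j, A_j)` follow independent copies of the motion of
one oscillator in the mean field `m(s) = ∫ V df(s)`, from the same `z_j`. The pair
`(V_1, A_1), (U_1, A_1)` is a coupling of `f(t)` and of the first marginal of `F(t)`, whose cost is
`E ‖U_1 - V_1‖²`; by exchangeability this is the expectation of `x = (1/N) ∑ ‖U_j - V_j‖²`.

With `Ū` and `V̄` the empirical means, the generators of the two motions are the skew-Hermitian
matrices `A_j + (κ/2) K(Ū, U_j)` and `A_j + (κ/2) K(m, V_j)`. A skew-Hermitian matrix acting on
`U_j - V_j` does not change its norm, so that only the difference of the generators contributes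
(`frobInner_velocity_sub`). It is made of terms linear in `Ū - V̄`, in `U_j - V_j` and in `V̄ - m`,
which gives `x' ≤ κ (9/2 x + 2 ‖V̄ - m‖²)` (`exists_deriv_meanSqDeviation_le`). Since `V̄` is an
average of independent unitary matrices of expectation `m`, `E ‖V̄ - m‖² ≤ d / N`
(`integral_frobSq_mean_sub_le`), and Grönwall's inequality concludes
(`integral_meanSqDeviation_le`). The factor `2 κ d / (N a)` so obtained, for any growth rate
`a ≥ 9 κ / 2`, is smaller than the stated ones for `a = 1 + 9 κ / 2` and, if `κ ≤ 2`, for `a = 10`.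

It has to be known that `f` and `F`, which are only weak solutions, are transported by the flows of
the two motions (`IsFlow.map_eq_of_isWeakSolution`). The law of a flow is a weak solution, and both
systems are instances of one driven system (`drivenField`): the kinetic equation because the
nonlinear term is a given function of time once `f` is given. So uniqueness of weak solutions is
needed, where the test functions are restrictions of `C¹` functions on a vector space of matrices.
On unitary matrices the field is a polynomial of degree three. Testing with monomials, multiplied
by a cut-off in the conserved variables `A_j`, one finds that the truncated moments solve a linear
hierarchy in which the derivative of a moment of degree `n` is a sum of at most `C n` moments of
degree at most `n + 2`. Iterating `k` times costs `C^k n (n + 2) ⋯ (n + 2k - 2)`, of the order of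
`k!`, and gains the volume `t^k / k!` of a simplex, while all moments of degree `n` are bounded by
`R^n`; hence the solution is unique on short time intervals of a fixed length, and then for all
times (`hierarchy_eq_zero`). The truncated moments determine the measure through its characteristic
function (`measure_ext_of_cutMonomial`).
-/

namespace Lohe

/-! ### A growing hierarchy of linear integral equations -/

lemma prod_add_two_mul_le (n k : ℕ) :
    ∏ i ∈ Finset.range k, ((n : ℝ) + 2 * i) ≤ 2 ^ n * 4 ^ k * k.factorial := by
  have h : ∀ k : ℕ, (∏ i ∈ Finset.range k, (n + 2 * i)) * n.factorial
      ≤ 2 ^ k * (n + k).factorial := by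
    intro k
    induction k with
    | zero => simp
    | succ k ih =>
      rw [Finset.prod_range_succ, ← add_assoc, Nat.factorial_succ, pow_succ]
      calc (∏ i ∈ Finset.range k, (n + 2 * i)) * (n + 2 * k) * n.factorial
          = (∏ i ∈ Finset.range k, (n + 2 * i)) * n.factorial * (n + 2 * k) := by ring
        _ ≤ 2 ^ k * (n + k).factorial * (2 * (n + k + 1)) := by gcongr; omega
        _ = _ := by ring
  have h1 : (∏ i ∈ Finset.range k, (n + 2 * i)) * n.factorial
      ≤ 2 ^ n * 4 ^ k * k.factorial * n.factorial := by
    refine (h k).trans ?_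
    rw [← Nat.add_choose_mul_factorial_mul_factorial n k]
    calc 2 ^ k * ((n + k).choose k * n.factorial * k.factorial)
        ≤ 2 ^ k * (2 ^ (n + k) * n.factorial * k.factorial) := by
          gcongr; exact Nat.choose_le_two_pow _ _
      _ = 2 ^ n * 4 ^ k * k.factorial * n.factorial := by
          rw [show (4 : ℕ) = 2 * 2 from rfl, mul_pow, pow_add]; ring
  have h2 := Nat.le_of_mul_le_mul_right h1 n.factorial_pos
  exact_mod_cast h2

/-- `D u` is a family of functions, indexed by words `u` of length `size u`, with derivative `G u`.
Iterating `k` times the inequality `|Dᵤ| ≤ ∫ |u| Λ max |Dᵥ|`, where `v` is at most two longer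
than `u`, produces the product of the lengths `|u| (|u| + 2) ⋯`, which is of the order of `k!`.
It is compensated by the volume `(t - t₀) ^ k / k!` of the simplex of intermediate times. -/
lemma norm_hierarchy_le {S : Type*} (size : S → ℕ) (D G : S → ℝ → ℂ) {t₀ B R Λ : ℝ}
    (hB : 0 ≤ B) (hR : 1 ≤ R) (hΛ : 0 ≤ Λ)
    (hD : ∀ u t, t₀ ≤ t → D u t = ∫ s in t₀..t, G u s)
    (hG : ∀ u s C, t₀ ≤ s → (∀ v, size v ≤ size u + 2 → ‖D v s‖ ≤ C) → ‖G u s‖ ≤ size u * Λ * C)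
    (hbd : ∀ u t, t₀ ≤ t → ‖D u t‖ ≤ B * R ^ size u) (k : ℕ) :
    ∀ u t, t₀ ≤ t → ‖D u t‖ ≤ B * R ^ size u * (∏ i ∈ Finset.range k, ((size u : ℝ) + 2 * i)) *
      (Λ * R ^ 2) ^ k * ((t - t₀) ^ k / k.factorial) := by
  have hR0 : 0 ≤ R := zero_le_one.trans hR
  induction k with
  | zero => simpa using hbd
  | succ k ih =>
    intro u t ht
    set n := size u
    have hbound : ∀ s, t₀ ≤ s → ‖G u s‖ ≤ n * Λ * (B * R ^ (n + 2) *
        (∏ i ∈ Finset.range k, (((n + 2 : ℕ) : ℝ) + 2 * i)) *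
        (Λ * R ^ 2) ^ k * ((s - t₀) ^ k / k.factorial)) := by
      intro s hs
      refine hG u s _ hs fun v hv => (ih v s hs).trans ?_
      have : 0 ≤ s - t₀ := sub_nonneg.2 hs
      have hv' : (size v : ℝ) ≤ ((n + 2 : ℕ) : ℝ) := by exact_mod_cast hv
      gcongr
    rw [hD u t ht]
    have hcont : Continuous fun s : ℝ => n * Λ * (B * R ^ (n + 2) *
        (∏ i ∈ Finset.range k, (((n + 2 : ℕ) : ℝ) + 2 * i)) *
        (Λ * R ^ 2) ^ k * ((s - t₀) ^ k / k.factorial)) := by fun_prop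
    refine (intervalIntegral.norm_integral_le_of_norm_le ht
      (Filter.Eventually.of_forall fun s hs => hbound s hs.1.le)
      (hcont.intervalIntegrable _ _)).trans (le_of_eq ?_)
    have hint : ∫ s in t₀..t, (s - t₀) ^ k = (t - t₀) ^ (k + 1) / (k + 1) := by
      rw [intervalIntegral.integral_comp_sub_right (fun x => x ^ k) t₀, integral_pow]
      simp
    simp only [intervalIntegral.integral_const_mul, intervalIntegral.integral_div, hint]
    rw [Finset.prod_range_succ', Nat.factorial_succ]
    have : ∀ i : ℕ, ((n + 2 : ℕ) : ℝ) + 2 * i = (n : ℝ) + 2 * ((i + 1 : ℕ) : ℝ) := by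
      intro i; push_cast; ring
    simp only [this]
    push_cast
    field_simp
    ring

/-- The hierarchy has only the zero solution: the estimate of `norm_hierarchy_le` tends to zero
as `k → ∞` on a time interval whose length depends neither on `u` nor on the initial time. -/
lemma hierarchy_eq_zero {S : Type*} (size : S → ℕ) (D G : S → ℝ → ℂ) {B R Λ : ℝ}
    (hB : 0 ≤ B) (hR : 1 ≤ R) (hΛ : 0 ≤ Λ)
    (h0 : ∀ u, D u 0 = 0)
    (hD : ∀ u t₀ t, 0 ≤ t₀ → t₀ ≤ t → D u t = D u t₀ + ∫ s in t₀..t, G u s)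
    (hG : ∀ u s C, 0 ≤ s → (∀ v, size v ≤ size u + 2 → ‖D v s‖ ≤ C) → ‖G u s‖ ≤ size u * Λ * C)
    (hbd : ∀ u t, 0 ≤ t → ‖D u t‖ ≤ B * R ^ size u) (u : S) (t : ℝ) (ht : 0 ≤ t) :
    D u t = 0 := by
  have hR0 : 0 ≤ R := zero_le_one.trans hR
  set τ : ℝ := 1 / (4 * (Λ * R ^ 2) + 1) / 2 with hτ
  have hden : 0 < 4 * (Λ * R ^ 2) + 1 := by positivity
  have hτ0 : 0 < τ := by positivity
  have hstep : ∀ t₀, 0 ≤ t₀ → (∀ u, D u t₀ = 0) → ∀ u t, t₀ ≤ t → t ≤ t₀ + τ → D u t = 0 := by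
    intro t₀ ht₀ hz u t h1 h2
    have key := norm_hierarchy_le size D G (t₀ := t₀) hB hR hΛ
      (fun u t h => by rw [hD u t₀ t ht₀ h, hz, zero_add])
      (fun u s C hs => hG u s C (ht₀.trans hs)) (fun u t h => hbd u t (ht₀.trans h))
    have hle : ∀ k : ℕ, ‖D u t‖ ≤ B * R ^ size u * 2 ^ size u * (1 / 2) ^ k := by
      intro k
      refine (key k u t h1).trans ?_
      have hd : 0 ≤ t - t₀ := sub_nonneg.2 h1
      have hr : 4 * (Λ * R ^ 2) * (t - t₀) ≤ 1 / 2 := by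
        calc 4 * (Λ * R ^ 2) * (t - t₀) ≤ 4 * (Λ * R ^ 2) * τ := by gcongr; linarith
          _ ≤ (4 * (Λ * R ^ 2) + 1) * τ := by nlinarith
          _ = 1 / 2 := by rw [hτ]; field_simp
      calc B * R ^ size u * (∏ i ∈ Finset.range k, ((size u : ℝ) + 2 * i)) *
            (Λ * R ^ 2) ^ k * ((t - t₀) ^ k / k.factorial)
          ≤ B * R ^ size u * (2 ^ size u * 4 ^ k * k.factorial) *
            (Λ * R ^ 2) ^ k * ((t - t₀) ^ k / k.factorial) := by
            gcongr; exact prod_add_two_mul_le _ _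
        _ = B * R ^ size u * 2 ^ size u * (4 * (Λ * R ^ 2) * (t - t₀)) ^ k := by
            have : (k.factorial : ℝ) ≠ 0 := by positivity
            rw [mul_pow (4 * _), mul_pow 4]; field_simp
        _ ≤ _ := by gcongr
    have hlim : Filter.Tendsto (fun k : ℕ => B * R ^ size u * 2 ^ size u * (1 / 2 : ℝ) ^ k)
        Filter.atTop (nhds 0) := by
      simpa using (tendsto_pow_atTop_nhds_zero_of_lt_one (by norm_num : (0 : ℝ) ≤ 1 / 2)
        (by norm_num)).const_mul (B * R ^ size u * 2 ^ size u)
    exact norm_le_zero_iff.1 (ge_of_tendsto' hlim hle)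
  have hall : ∀ m : ℕ, ∀ u t, 0 ≤ t → t ≤ m * τ → D u t = 0 := by
    intro m
    induction m with
    | zero =>
      intro u t h1 h2
      obtain rfl : t = 0 := le_antisymm (by simpa using h2) h1
      exact h0 u
    | succ m ih =>
      intro u t h1 h2
      rcases le_total t (m * τ) with h | h
      · exact ih u t h1 h
      · refine hstep (m * τ) (by positivity) (fun u => ih u _ (by positivity) le_rfl) u t h ?_
        push_cast at h2; linarith
  obtain ⟨m, hm⟩ := exists_nat_ge (t / τ)
  exact hall m u t ht ((div_le_iff₀ hτ0).1 hm)

/-! ### Uniqueness of weak solutions for polynomial vector fields -/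

/-- In the complex coordinates `q j` of `E`, the vector field `b` is at every time `s ≥ 0` a
polynomial of degree at most three on `X`: its `j`-th coordinate is the sum over `a : T` of the
monomials `m j a` with the coefficients `c j a s`. -/
structure IsCubicField {X E J T : Type} [NormedAddCommGroup E] [NormedSpace ℝ E] [Fintype T]
    (ι : X → E) (b : ℝ → X → E) (q : J → E →L[ℝ] ℂ) (m : J → T → Multiset J)
    (c : J → T → ℝ → ℂ) (C : ℝ) : Prop where
  card_le : ∀ j a, (m j a).card ≤ 3
  continuousOn : ∀ j a, ContinuousOn (c j a) (Set.Ici 0)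
  norm_le : ∀ j a s, 0 ≤ s → ‖c j a s‖ ≤ C
  apply_eq : ∀ j s x, 0 ≤ s → q j (b s x) = ∑ a, c j a s * ((m j a).map fun i => q i (ι x)).prod

/-- A `C¹` cut-off function on `E` which is constant along the vector field `b` and on the support
of which the coordinates `q j` of the points of `X` are bounded by `R`. -/
structure IsCutoff {X E J : Type} [NormedAddCommGroup E] [NormedSpace ℝ E]
    (ι : X → E) (b : ℝ → X → E) (q : J → E →L[ℝ] ℂ) (η : E → ℝ) (R : ℝ) : Prop where
  contDiff : ContDiff ℝ 1 η
  hasCompactSupport : HasCompactSupport η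
  norm_le_one : ∀ x, ‖η x‖ ≤ 1
  fderiv_eq_zero : ∀ s x, 0 ≤ s → fderiv ℝ η (ι x) (b s x) = 0
  one_le : 1 ≤ R
  norm_coord_le : ∀ j x, η (ι x) ≠ 0 → ‖q j (ι x)‖ ≤ R

/-- The cut-off monomial `η ∏ q j`, the product being over the multiset `u`. -/
noncomputable def cutMonomial {E J : Type} [NormedAddCommGroup E] [NormedSpace ℝ E]
    (q : J → E →L[ℝ] ℂ) (η : E → ℝ) (u : Multiset J) (e : E) : ℂ :=
  (η e : ℂ) * (u.map fun j => q j e).prod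

section

variable {X E J T : Type} [NormedAddCommGroup E] [NormedSpace ℝ E] [Fintype T]
  {ι : X → E} {b : ℝ → X → E} {q : J → E →L[ℝ] ℂ} {m : J → T → Multiset J}
  {c : J → T → ℝ → ℂ} {C R : ℝ} {η : E → ℝ}

lemma contDiff_cutMonomial (hη : IsCutoff ι b q η R) (u : Multiset J) :
    ContDiff ℝ 1 (cutMonomial q η u) := by
  refine (Complex.ofRealCLM.contDiff.comp hη.contDiff).mul ?_
  induction u using Multiset.induction_on with
  | empty => simpa using contDiff_const
  | cons j u ih => simpa using (q j).contDiff.mul ih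

lemma hasCompactSupport_cutMonomial (hη : IsCutoff ι b q η R) (u : Multiset J) :
    HasCompactSupport (cutMonomial q η u) :=
  HasCompactSupport.mul_right (hη.hasCompactSupport.comp_left (g := fun r : ℝ => (r : ℂ)) (by simp))

lemma norm_cutMonomial_le (hη : IsCutoff ι b q η R) (u : Multiset J) (x : X) :
    ‖cutMonomial q η u (ι x)‖ ≤ R ^ u.card := by
  have hR := hη.one_le
  by_cases h : η (ι x) = 0
  · simp only [cutMonomial, h]; simp; positivity
  · rw [cutMonomial, norm_mul, Complex.norm_real]
    have : ‖(u.map fun j => q j (ι x)).prod‖ ≤ R ^ u.card := by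
      induction u using Multiset.induction_on with
      | empty => simp
      | cons j u ih =>
        simp only [Multiset.map_cons, Multiset.prod_cons, norm_mul, Multiset.card_cons, pow_succ']
        gcongr
        exact hη.norm_coord_le j x h
    simpa using mul_le_mul (hη.norm_le_one _) this (norm_nonneg _) zero_le_one

/-- The derivative of a cut-off monomial of degree `n` along a cubic field is a sum of cut-off
monomials of degree at most `n + 2`. -/
lemma fderiv_cutMonomial [DecidableEq J] (hη : IsCutoff ι b q η R)
    (hb : IsCubicField ι b q m c C) (u : Multiset J) {s : ℝ} (hs : 0 ≤ s) (x : X) :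
    fderiv ℝ (cutMonomial q η u) (ι x) (b s x) =
      ∑ j ∈ u.toFinset, ∑ a, (u.count j : ℂ) * c j a s *
        cutMonomial q η (m j a + u.erase j) (ι x) := by
  have h1 : HasFDerivAt (fun e => (η e : ℂ)) (Complex.ofRealCLM.comp (fderiv ℝ η (ι x))) (ι x) :=
    Complex.ofRealCLM.hasFDerivAt.comp _
      ((hη.contDiff.differentiable (by simp)) (ι x)).hasFDerivAt
  have h2 : HasFDerivAt (fun e => (u.map fun j => q j e).prod)
      (u.map fun i => ((u.erase i).map (fun j => q j (ι x))).prod • q i).sum (ι x) :=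
    HasFDerivAt.multiset_prod fun i _ => (q i).hasFDerivAt
  have h3 : ∀ w : Multiset (E →L[ℝ] ℂ), w.sum (b s x) = (w.map fun L => L (b s x)).sum := by
    intro w
    induction w using Multiset.induction_on with
    | empty => simp
    | cons a w ih => simp [ih]
  have h4 : HasFDerivAt (cutMonomial q η u) _ (ι x) := h1.mul h2
  have h5 : fderiv ℝ (cutMonomial q η u) (ι x) (b s x) = (η (ι x) : ℂ) *
      (u.map fun j => ((u.erase j).map (fun j => q j (ι x))).prod * q j (b s x)).sum := by
    rw [h4.fderiv]
    simp [hη.fderiv_eq_zero s x hs, h3, Multiset.map_map]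
  rw [h5, Finset.sum_multiset_map_count, Finset.mul_sum]
  refine Finset.sum_congr rfl fun j _ => ?_
  rw [hb.apply_eq j s x hs, nsmul_eq_mul]
  simp only [Finset.mul_sum, cutMonomial, Multiset.map_add, Multiset.prod_add]
  exact Finset.sum_congr rfl fun a _ => by ring

variable [TopologicalSpace X] [MeasurableSpace X] [OpensMeasurableSpace X]

lemma continuousOn_integral_of_bounded {μ : ℝ → ProbabilityMeasure X} {S : Set ℝ}
    (hμ : ContinuousOn μ S) {g : X → ℂ} (hg : Continuous g) {K : ℝ} (hK : ∀ x, ‖g x‖ ≤ K) :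
    ContinuousOn (fun s => ∫ x, g x ∂(μ s : Measure X)) S := by
  intro s hs
  exact (ProbabilityMeasure.tendsto_iff_forall_integral_rclike_tendsto ℂ).1 (hμ s hs)
    (BoundedContinuousFunction.ofNormedAddCommGroup g hg K hK)

/-- The weak formulation for complex-valued test functions. -/
lemma IsWeakSolution.weak_complex {μ₀ : ProbabilityMeasure X} {μ : ℝ → ProbabilityMeasure X}
    (h : IsWeakSolution ι b μ₀ μ) (hι : Continuous ι) {φ : E → ℂ} (hφ : ContDiff ℝ 1 φ)
    (hc : HasCompactSupport φ) {L : ℝ → X → ℂ}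
    (hL : ∀ s x, 0 ≤ s → fderiv ℝ φ (ι x) (b s x) = L s x)
    (hLi : ∀ s, 0 ≤ s → Integrable (L s) (μ s : Measure X))
    (hLc : ContinuousOn (fun s => ∫ x, L s x ∂(μ s : Measure X)) (Set.Ici 0))
    {t : ℝ} (ht : 0 ≤ t) :
    ∫ x, φ (ι x) ∂(μ t : Measure X) = ∫ x, φ (ι x) ∂(μ₀ : Measure X) +
      ∫ s in (0 : ℝ)..t, ∫ x, L s x ∂(μ s : Measure X) := by
  obtain ⟨K, hK⟩ := hc.exists_bound_of_continuous hφ.continuous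
  have hint : ∀ ν : ProbabilityMeasure X, Integrable (fun x => φ (ι x)) (ν : Measure X) := fun ν =>
    Integrable.of_bound (hφ.continuous.comp hι).aestronglyMeasurable K
      (Filter.Eventually.of_forall fun x => hK _)
  have hIi : IntervalIntegrable (fun s => ∫ x, L s x ∂(μ s : Measure X)) volume 0 t :=
    (hLc.mono (by rw [Set.uIcc_of_le ht]; exact Set.Icc_subset_Ici_self)).intervalIntegrable
  have key : ∀ P : ℂ →L[ℝ] ℝ, P (∫ x, φ (ι x) ∂(μ t : Measure X)) =
      P (∫ x, φ (ι x) ∂(μ₀ : Measure X) + ∫ s in (0 : ℝ)..t, ∫ x, L s x ∂(μ s : Measure X)) := by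
    intro P
    have h1 := h.weak (fun e => P (φ e)) (P.contDiff.comp hφ)
      (hc.comp_left (g := P) (map_zero P)) t ht
    rw [map_add, ← P.integral_comp_comm (hint _), ← P.integral_comp_comm (hint _), h1,
      ← P.intervalIntegral_comp_comm hIi]
    congr 1
    refine intervalIntegral.integral_congr fun s hs => ?_
    rw [Set.uIcc_of_le ht] at hs
    rw [← P.integral_comp_comm (hLi s hs.1)]
    refine integral_congr_ae (Filter.Eventually.of_forall fun x => ?_)
    simp only
    rw [← hL s x hs.1]
    have : HasFDerivAt (fun e => P (φ e)) (P.comp (fderiv ℝ φ (ι x))) (ι x) :=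
      P.hasFDerivAt.comp _ ((hφ.differentiable (by simp)) (ι x)).hasFDerivAt
    rw [this.fderiv]; rfl
  exact Complex.ext (key Complex.reCLM) (key Complex.imCLM)

/-- The truncated moments of a weak solution satisfy a closed hierarchy of integral equations. -/
lemma IsWeakSolution.integral_cutMonomial [DecidableEq J] {μ₀ : ProbabilityMeasure X}
    {μ : ℝ → ProbabilityMeasure X} (h : IsWeakSolution ι b μ₀ μ) (hι : Continuous ι)
    (hη : IsCutoff ι b q η R) (hb : IsCubicField ι b q m c C) (u : Multiset J) :
    ContinuousOn (fun s => ∑ j ∈ u.toFinset, ∑ a, (u.count j : ℂ) * c j a s *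
        ∫ x, cutMonomial q η (m j a + u.erase j) (ι x) ∂(μ s : Measure X)) (Set.Ici 0) ∧
    ∀ t, 0 ≤ t → ∫ x, cutMonomial q η u (ι x) ∂(μ t : Measure X) =
      ∫ x, cutMonomial q η u (ι x) ∂(μ₀ : Measure X) +
      ∫ s in (0 : ℝ)..t, ∑ j ∈ u.toFinset, ∑ a, (u.count j : ℂ) * c j a s *
        ∫ x, cutMonomial q η (m j a + u.erase j) (ι x) ∂(μ s : Measure X) := by
  have hcont : ∀ v, Continuous fun x => cutMonomial q η v (ι x) := fun v =>
    (contDiff_cutMonomial hη v).continuous.comp hι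
  have hint : ∀ v s, Integrable (fun x => cutMonomial q η v (ι x)) (μ s : Measure X) := fun v s =>
    Integrable.of_bound (hcont v).aestronglyMeasurable _
      (Filter.Eventually.of_forall fun x => norm_cutMonomial_le hη v x)
  have h1 : ContinuousOn (fun s => ∑ j ∈ u.toFinset, ∑ a, (u.count j : ℂ) * c j a s *
      ∫ x, cutMonomial q η (m j a + u.erase j) (ι x) ∂(μ s : Measure X)) (Set.Ici 0) := by
    refine continuousOn_finsetSum _ fun j _ => continuousOn_finsetSum _ fun a _ => ?_
    exact (continuousOn_const.mul (hb.continuousOn j a)).mul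
      (continuousOn_integral_of_bounded h.continuousOn (hcont _)
        fun x => norm_cutMonomial_le hη _ x)
  have h2 : ∀ s, ∫ x, ∑ j ∈ u.toFinset, ∑ a, (u.count j : ℂ) * c j a s *
        cutMonomial q η (m j a + u.erase j) (ι x) ∂(μ s : Measure X) =
      ∑ j ∈ u.toFinset, ∑ a, (u.count j : ℂ) * c j a s *
        ∫ x, cutMonomial q η (m j a + u.erase j) (ι x) ∂(μ s : Measure X) := by
    intro s
    rw [integral_finsetSum _ fun j _ => integrable_finsetSum _ fun a _ =>
      (hint _ s).const_mul _]
    refine Finset.sum_congr rfl fun j _ => ?_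
    rw [integral_finsetSum _ fun a _ => (hint _ s).const_mul _]
    exact Finset.sum_congr rfl fun a _ => integral_const_mul _ _
  refine ⟨h1, fun t ht => ?_⟩
  have := h.weak_complex hι (contDiff_cutMonomial hη u) (hasCompactSupport_cutMonomial hη u)
    (fun s x hs => fderiv_cutMonomial hη hb u hs x)
    (fun s _ => integrable_finsetSum _ fun j _ => integrable_finsetSum _ fun a _ =>
      (hint _ s).const_mul _) (by simpa only [h2] using h1) ht
  simpa only [h2] using this

/-- Two weak solutions with the same initial datum have the same truncated moments. -/
lemma IsWeakSolution.integral_cutMonomial_eq [DecidableEq J] {μ₀ : ProbabilityMeasure X}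
    {μ ν : ℝ → ProbabilityMeasure X} (hμ : IsWeakSolution ι b μ₀ μ) (hν : IsWeakSolution ι b μ₀ ν)
    (hι : Continuous ι) (hη : IsCutoff ι b q η R) (hb : IsCubicField ι b q m c C)
    (hC : 0 ≤ C) (u : Multiset J) {t : ℝ} (ht : 0 ≤ t) :
    ∫ x, cutMonomial q η u (ι x) ∂(μ t : Measure X) =
      ∫ x, cutMonomial q η u (ι x) ∂(ν t : Measure X) := by
  rw [← sub_eq_zero]
  set D : Multiset J → ℝ → ℂ := fun u t => ∫ x, cutMonomial q η u (ι x) ∂(μ t : Measure X) -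
      ∫ x, cutMonomial q η u (ι x) ∂(ν t : Measure X) with hDdef
  set G : Multiset J → ℝ → ℂ := fun u s => ∑ j ∈ u.toFinset, ∑ a, (u.count j : ℂ) * c j a s *
      D (m j a + u.erase j) s with hGdef
  have hG0 : ∀ u t, 0 ≤ t → IntervalIntegrable (G u) volume 0 t ∧
      D u t = ∫ s in (0 : ℝ)..t, G u s := by
    intro u t ht
    obtain ⟨c1, e1⟩ := hμ.integral_cutMonomial hι hη hb u
    obtain ⟨c2, e2⟩ := hν.integral_cutMonomial hι hη hb u
    have hsub : Set.uIcc 0 t ⊆ Set.Ici 0 := by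
      rw [Set.uIcc_of_le ht]; exact Set.Icc_subset_Ici_self
    have i1 := (c1.mono hsub).intervalIntegrable (μ := volume)
    have i2 := (c2.mono hsub).intervalIntegrable (μ := volume)
    have hGeq : G u = fun s => (∑ j ∈ u.toFinset, ∑ a, (u.count j : ℂ) * c j a s *
        ∫ x, cutMonomial q η (m j a + u.erase j) (ι x) ∂(μ s : Measure X)) -
        (∑ j ∈ u.toFinset, ∑ a, (u.count j : ℂ) * c j a s *
        ∫ x, cutMonomial q η (m j a + u.erase j) (ι x) ∂(ν s : Measure X)) := by
      funext s
      simp only [hGdef, hDdef, ← Finset.sum_sub_distrib, mul_sub]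
    rw [hGeq]
    refine ⟨i1.sub i2, ?_⟩
    rw [intervalIntegral.integral_sub i1 i2, hDdef]
    simp only
    rw [e1 t ht, e2 t ht]
    ring
  refine hierarchy_eq_zero Multiset.card D G (B := 2) (R := R) (Λ := Fintype.card T * C)
    zero_le_two hη.one_le (by positivity) (fun u => ?_) (fun u t₀ t h0 h1 => ?_)
    (fun u s K hs hK => ?_) (fun u t _ => ?_) u t ht
  · simp only [hDdef, hμ.initial, hν.initial, sub_self]
  · obtain ⟨i0, e0⟩ := hG0 u t₀ h0
    obtain ⟨i1, e1⟩ := hG0 u t (h0.trans h1)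
    rw [e0, e1, intervalIntegral.integral_add_adjacent_intervals i0 (i0.symm.trans i1)]
  · have hle : ∀ j ∈ u.toFinset, ∀ a, ‖(u.count j : ℂ) * c j a s * D (m j a + u.erase j) s‖ ≤
        u.count j * (C * K) := by
      intro j hj a
      rw [norm_mul, norm_mul, Complex.norm_natCast, mul_assoc]
      have hcard : (m j a + u.erase j).card ≤ u.card + 2 := by
        rw [Multiset.mem_toFinset] at hj
        have h1 := hb.card_le j a
        have h2 := Multiset.card_erase_add_one hj
        rw [Multiset.card_add]; omega
      gcongr
      · exact hb.norm_le j a s hs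
      · exact hK _ hcard
    calc ‖G u s‖ ≤ ∑ j ∈ u.toFinset, ∑ _a : T, (u.count j : ℝ) * (C * K) :=
          (norm_sum_le _ _).trans <| Finset.sum_le_sum fun j hj =>
            (norm_sum_le _ _).trans <| Finset.sum_le_sum fun a _ => hle j hj a
      _ = u.card * (Fintype.card T * C) * K := by
          simp only [Finset.sum_const, Finset.card_univ, nsmul_eq_mul, ← Finset.mul_sum,
            ← Finset.sum_mul]
          have : ∑ j ∈ u.toFinset, (u.count j : ℝ) = u.card := by
            exact_mod_cast Multiset.toFinset_sum_count_eq u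
          rw [this]; ring
  · have hle : ∀ ρ : ProbabilityMeasure X,
        ‖∫ x, cutMonomial q η u (ι x) ∂(ρ : Measure X)‖ ≤ R ^ u.card := fun ρ => by
      simpa using norm_integral_le_of_norm_le_const (μ := (ρ : Measure X))
        (Filter.Eventually.of_forall fun x => norm_cutMonomial_le hη u x)
    calc _ ≤ _ := norm_sub_le _ _
      _ ≤ 2 * R ^ u.card := by linarith [hle (μ t), hle (ν t)]

end

section

variable {X E J T : Type} [NormedAddCommGroup E] [NormedSpace ℝ E] [Fintype T]
  {ι : X → E} {b : ℝ → X → E} {q : J → E →L[ℝ] ℂ} {m : J → T → Multiset J}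
  {c : J → T → ℝ → ℂ} {C : ℝ}
  [TopologicalSpace X] [MeasurableSpace X] [BorelSpace X]

/-- Equality of the cut-off monomials' integrals extends to cut-off polynomials. -/
lemma integral_cutoff_mul_eval_eq [Fintype J] {R : ℝ} {η : E → ℝ} (hι : Continuous ι)
    (hη : IsCutoff ι b q η R) {μ ν : Measure X} [IsProbabilityMeasure μ] [IsProbabilityMeasure ν]
    (h : ∀ u, ∫ x, cutMonomial q η u (ι x) ∂μ = ∫ x, cutMonomial q η u (ι x) ∂ν)
    (p : MvPolynomial J ℂ) :
    ∫ x, (η (ι x) : ℂ) * MvPolynomial.eval (fun j => q j (ι x)) p ∂μ =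
      ∫ x, (η (ι x) : ℂ) * MvPolynomial.eval (fun j => q j (ι x)) p ∂ν := by
  have hint : ∀ (ρ : Measure X) [IsProbabilityMeasure ρ] v,
      Integrable (fun x => cutMonomial q η v (ι x)) ρ := fun ρ _ v =>
    Integrable.of_bound ((contDiff_cutMonomial hη v).continuous.comp hι).aestronglyMeasurable _
      (Filter.Eventually.of_forall fun x => norm_cutMonomial_le hη v x)
  have heq : ∀ x, (η (ι x) : ℂ) * MvPolynomial.eval (fun j => q j (ι x)) p =
      ∑ d ∈ p.support, p.coeff d * cutMonomial q η d.toMultiset (ι x) := by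
    intro x
    rw [MvPolynomial.eval_eq, Finset.mul_sum]
    refine Finset.sum_congr rfl fun d _ => ?_
    rw [cutMonomial, Finsupp.toMultiset_map, Finsupp.prod_toMultiset,
      Finsupp.prod_mapDomain_index (by simp) (by simp [pow_add])]
    simp only [Finsupp.prod]
    ring
  simp only [heq]
  rw [integral_finsetSum _ fun d _ => (hint μ _).const_mul _,
    integral_finsetSum _ fun d _ => (hint ν _).const_mul _]
  exact Finset.sum_congr rfl fun d _ => by rw [integral_const_mul, integral_const_mul, h]

/-- Every real-linear functional of the coordinates is a linear polynomial in them, provided that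
the coordinates are stable under complex conjugation. -/
lemma exists_polynomial_eq_dual [Fintype J] [DecidableEq J] (σ : J → J)
    (hσ : ∀ j e, q (σ j) e = (starRingEnd ℂ) (q j e)) (L : StrongDual ℝ (J → ℂ)) :
    ∃ p : MvPolynomial J ℂ, ∀ e, MvPolynomial.eval (fun j => q j e) p = (L fun j => q j e : ℝ) := by
  set α : J → ℂ := fun j => (L (Pi.single j 1) - Complex.I * L (Pi.single j Complex.I)) / 2
  refine ⟨∑ j, (MvPolynomial.C (α j) * MvPolynomial.X j +
    MvPolynomial.C ((starRingEnd ℂ) (α j)) * MvPolynomial.X (σ j)), fun e => ?_⟩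
  have hL : L (fun j => q j e) =
      ∑ j, ((q j e).re * L (Pi.single j 1) + (q j e).im * L (Pi.single j Complex.I)) := by
    have : (fun j => q j e) = ∑ j, ((q j e).re • (Pi.single j (1 : ℂ) : J → ℂ) +
        (q j e).im • (Pi.single j Complex.I : J → ℂ)) := by
      ext i
      simp only [Finset.sum_apply, Pi.add_apply, Pi.smul_apply]
      rw [Finset.sum_eq_single i (fun j _ hj => by simp [Pi.single_eq_of_ne hj.symm]) (by simp)]
      simp [Complex.re_add_im]
    rw [this]
    simp only [map_sum, map_add, map_smul, smul_eq_mul]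
  rw [hL]
  simp only [map_sum, map_add, map_mul, MvPolynomial.eval_C, MvPolynomial.eval_X, hσ]
  push_cast
  refine Finset.sum_congr rfl fun j _ => ?_
  have hα : (starRingEnd ℂ) (α j) =
      (L (Pi.single j 1) + Complex.I * L (Pi.single j Complex.I)) / 2 := by
    simp [α, map_ofNat]
  rw [hα]
  apply Complex.ext <;> simp [α] <;> ring

/-- Two probability measures with the same truncated moments, for a sequence of cut-off functions
converging to `1`, are equal: their characteristic functions coincide. -/
lemma measure_ext_of_cutMonomial [Fintype J] [DecidableEq J] (hι : Continuous ι)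
    (hQ : Topology.IsInducing fun x j => q j (ι x)) (σ : J → J)
    (hσ : ∀ j e, q (σ j) e = (starRingEnd ℂ) (q j e))
    {R : ℕ → ℝ} {η : ℕ → E → ℝ} (hη : ∀ n, IsCutoff ι b q (η n) (R n))
    (hη1 : ∀ x, Filter.Tendsto (fun n => η n (ι x)) Filter.atTop (nhds 1))
    {μ ν : Measure X} [IsProbabilityMeasure μ] [IsProbabilityMeasure ν]
    (h : ∀ n u, ∫ x, cutMonomial q (η n) u (ι x) ∂μ = ∫ x, cutMonomial q (η n) u (ι x) ∂ν) :
    μ = ν := by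
  set Q : X → J → ℂ := fun x j => q j (ι x)
  have hQm : Measurable Q := hQ.continuous.measurable
  have hηc : ∀ n, Continuous fun x => (η n (ι x) : ℂ) := fun n =>
    Complex.continuous_ofReal.comp ((hη n).contDiff.continuous.comp hι)
  have hmap : μ.map Q = ν.map Q := by
    have := Measure.isProbabilityMeasure_map (μ := μ) hQm.aemeasurable
    have := Measure.isProbabilityMeasure_map (μ := ν) hQm.aemeasurable
    refine Measure.ext_of_charFunDual (funext fun L => ?_)
    have hLc : Continuous fun x => (L (Q x) : ℂ) * Complex.I :=
      (Complex.continuous_ofReal.comp (L.continuous.comp hQ.continuous)).mul continuous_const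
    obtain ⟨p, hp⟩ := exists_polynomial_eq_dual (q := q) σ hσ L
    -- the partial sums of the series of `exp (i L)`, which converge on the support of a cut-off
    set P : ℕ → MvPolynomial J ℂ := fun k =>
      ∑ i ∈ Finset.range k, MvPolynomial.C ((i.factorial : ℂ)⁻¹) * (p * MvPolynomial.C Complex.I) ^ i
    have hP : ∀ k x, MvPolynomial.eval (Q x) (P k) =
        ∑ i ∈ Finset.range k, ((L (Q x) : ℂ) * Complex.I) ^ i / i.factorial := by
      intro k x
      have := hp (ι x)
      simp only [P, map_sum, map_mul, map_pow, MvPolynomial.eval_C]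
      refine Finset.sum_congr rfl fun i _ => ?_
      rw [div_eq_inv_mul]
      congr 3
    have hexp : ∀ (ρ : Measure X) [IsProbabilityMeasure ρ] n, Filter.Tendsto
        (fun k => ∫ x, (η n (ι x) : ℂ) * MvPolynomial.eval (Q x) (P k) ∂ρ) Filter.atTop
        (nhds (∫ x, (η n (ι x) : ℂ) * Complex.exp (L (Q x) * Complex.I) ∂ρ)) := by
      intro ρ _ n
      refine tendsto_integral_of_dominated_convergence
        (fun _ => Real.exp (‖L‖ * R n)) (fun k => ?_) (integrable_const _) (fun k => ?_) ?_
      · refine Continuous.aestronglyMeasurable ((hηc n).mul ?_)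
        simp only [hP]
        fun_prop
      · refine Filter.Eventually.of_forall fun x => ?_
        by_cases h0 : η n (ι x) = 0
        · rw [h0]; simp; positivity
        · have hQx : ‖Q x‖ ≤ R n := (pi_norm_le_iff_of_nonneg
            (zero_le_one.trans (hη n).one_le)).2 fun j => (hη n).norm_coord_le j x h0
          have hLx : ‖(L (Q x) : ℂ) * Complex.I‖ ≤ ‖L‖ * R n := by
            rw [norm_mul, Complex.norm_I, mul_one, Complex.norm_real]
            exact (L.le_opNorm _).trans (by gcongr)
          rw [norm_mul, Complex.norm_real, hP]
          calc _ ≤ 1 * ∑ i ∈ Finset.range k, ‖(L (Q x) : ℂ) * Complex.I‖ ^ i / i.factorial := by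
                gcongr
                · exact (hη n).norm_le_one _
                · refine (norm_sum_le _ _).trans (Finset.sum_le_sum fun i _ => ?_)
                  rw [norm_div, norm_pow, Complex.norm_natCast]
            _ ≤ Real.exp ‖(L (Q x) : ℂ) * Complex.I‖ := by
                rw [one_mul]; exact Real.sum_le_exp_of_nonneg (norm_nonneg _) _
            _ ≤ _ := Real.exp_le_exp.2 hLx
      · refine Filter.Eventually.of_forall fun x => Filter.Tendsto.const_mul _ ?_
        simp only [hP]
        rw [Complex.exp_eq_exp_ℂ]
        exact (NormedSpace.expSeries_div_hasSum_exp
          ((L (Q x) : ℂ) * Complex.I)).tendsto_sum_nat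
    have hcut : ∀ n, ∫ x, (η n (ι x) : ℂ) * Complex.exp (L (Q x) * Complex.I) ∂μ =
        ∫ x, (η n (ι x) : ℂ) * Complex.exp (L (Q x) * Complex.I) ∂ν := fun n =>
      tendsto_nhds_unique (hexp μ n) (by
        simpa only [Q, integral_cutoff_mul_eval_eq hι (hη n) (h n)] using hexp ν n)
    have hlim : ∀ (ρ : Measure X) [IsProbabilityMeasure ρ], Filter.Tendsto
        (fun n => ∫ x, (η n (ι x) : ℂ) * Complex.exp (L (Q x) * Complex.I) ∂ρ) Filter.atTop
        (nhds (charFunDual (ρ.map Q) L)) := by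
      intro ρ _
      have : charFunDual (ρ.map Q) L = ∫ x, Complex.exp (L (Q x) * Complex.I) ∂ρ := by
        rw [charFunDual_apply, integral_map hQm.aemeasurable]
        exact Continuous.aestronglyMeasurable (by fun_prop)
      rw [this]
      refine tendsto_integral_of_dominated_convergence (fun _ => 1) (fun n => ?_)
        (integrable_const _) (fun n => ?_) ?_
      · exact ((hηc n).mul (Complex.continuous_exp.comp hLc)).aestronglyMeasurable
      · refine Filter.Eventually.of_forall fun x => ?_
        rw [norm_mul, Complex.norm_real, Complex.norm_exp_ofReal_mul_I, mul_one]
        exact (hη n).norm_le_one _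
      · refine Filter.Eventually.of_forall fun x => ?_
        simpa using ((Complex.continuous_ofReal.tendsto _).comp (hη1 x)).mul_const
          (Complex.exp (L (Q x) * Complex.I))
    exact tendsto_nhds_unique (hlim μ) (by simpa only [hcut] using hlim ν)
  refine Measure.ext fun s hs => ?_
  have hb : MeasurableSet[MeasurableSpace.comap Q inferInstance] s := by
    rw [BorelSpace.measurable_eq (α := X)] at hs
    rw [BorelSpace.measurable_eq (α := J → ℂ), ← borel_comap, ← hQ.eq_induced]
    exact hs
  obtain ⟨t, ht, rfl⟩ := hb
  rw [← Measure.map_apply hQm ht, ← Measure.map_apply hQm ht, hmap]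

/-- Uniqueness of the weak solution of the continuity equation of a cubic field. The involution `σ`
sends a coordinate to its complex conjugate. -/
theorem IsWeakSolution.unique [Fintype J] [DecidableEq J] (hι : Continuous ι)
    (hQ : Topology.IsInducing fun x j => q j (ι x)) (σ : J → J)
    (hσ : ∀ j e, q (σ j) e = (starRingEnd ℂ) (q j e))
    {R : ℕ → ℝ} {η : ℕ → E → ℝ} (hη : ∀ n, IsCutoff ι b q (η n) (R n))
    (hη1 : ∀ x, Filter.Tendsto (fun n => η n (ι x)) Filter.atTop (nhds 1))
    (hb : IsCubicField ι b q m c C) (hC : 0 ≤ C) {μ₀ : ProbabilityMeasure X}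
    {μ ν : ℝ → ProbabilityMeasure X} (hμ : IsWeakSolution ι b μ₀ μ)
    (hν : IsWeakSolution ι b μ₀ ν) {t : ℝ} (ht : 0 ≤ t) : μ t = ν t :=
  Subtype.ext <| measure_ext_of_cutMonomial (μ := (μ t : Measure X)) (ν := (ν t : Measure X))
    hι hQ σ hσ hη hη1 fun n u => hμ.integral_cutMonomial_eq hν hι (hη n) hb hC u ht

end

/-! ### Interacting oscillators with an external drive -/

/-- The inclusion of the configuration space of a family of oscillators in a vector space. -/
def configToAmbient {d : ℕ} {I : Type} (z : I → Phase d) : I → Ambient d :=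
  fun j => toAmbient (z j)

/-- The drive `P = α m + β ∑ₖ Uₖ` of the system below, for a configuration `e` in the ambient
vector space. -/
def drive {d : ℕ} {I : Type} [Fintype I] (α β : ℝ) (m : Mat d) (e : I → Ambient d) : Mat d :=
  (α : ℂ) • m + (β : ℂ) • ∑ k, Matrix.of (e k).1

/-- The polynomial vector field `U_j' = (A_j + P U_j* - U_j P*) U_j`, `A_j' = 0`, where
`P = α m + β ∑ₖ Uₖ`. The choice `β = 0` gives independent oscillators in a mean field `m`,
the choice `α = 0` gives the Lohe matrix model. -/
def drivenField {d : ℕ} {I : Type} [Fintype I] (α β : ℝ) (m : Mat d) (e : I → Ambient d) :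
    I → Ambient d := fun j =>
  inU ((Matrix.of (e j).2 + (drive α β m e * (Matrix.of (e j).1)ᴴ -
    Matrix.of (e j).1 * (drive α β m e)ᴴ)) * Matrix.of (e j).1)

section

variable {d : ℕ} {I : Type}

/-- The labels of the complex coordinates of `I → Ambient d`: oscillator, `U` (`false`) or `A`
(`true`), plain (`false`) or conjugate (`true`), row and column. -/
abbrev Coord (d : ℕ) (I : Type) : Type := I × Bool × Bool × Fin d × Fin d

/-- The complex coordinates of `I → Ambient d` and their conjugates. -/
noncomputable def coord (w : Coord d I) : (I → Ambient d) →L[ℝ] ℂ :=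
  (if w.2.2.1 then (Complex.conjCLE : ℂ →L[ℝ] ℂ) else ContinuousLinearMap.id ℝ ℂ).comp <|
    ((ContinuousLinearMap.proj (R := ℝ) (φ := fun _ : Fin d => ℂ) w.2.2.2.2).comp
      (ContinuousLinearMap.proj (R := ℝ) (φ := fun _ : Fin d => Fin d → ℂ) w.2.2.2.1)).comp <|
    (if w.2.1 then ContinuousLinearMap.snd ℝ (Fin d → Fin d → ℂ) (Fin d → Fin d → ℂ)
      else ContinuousLinearMap.fst ℝ (Fin d → Fin d → ℂ) (Fin d → Fin d → ℂ)).comp <|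
    ContinuousLinearMap.proj (R := ℝ) (φ := fun _ : I => Ambient d) w.1

lemma coord_U (j : I) (i k : Fin d) (e : I → Ambient d) :
    coord (j, false, false, i, k) e = (e j).1 i k := rfl

lemma coord_U_conj (j : I) (i k : Fin d) (e : I → Ambient d) :
    coord (j, false, true, i, k) e = (starRingEnd ℂ) ((e j).1 i k) := rfl

lemma coord_A (j : I) (i k : Fin d) (e : I → Ambient d) :
    coord (j, true, false, i, k) e = (e j).2 i k := rfl

lemma coord_A_conj (j : I) (i k : Fin d) (e : I → Ambient d) :
    coord (j, true, true, i, k) e = (starRingEnd ℂ) ((e j).2 i k) := rfl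

lemma coord_conj (w : Coord d I) (e : I → Ambient d) :
    coord (w.1, w.2.1, !w.2.2.1, w.2.2.2) e = (starRingEnd ℂ) (coord w e) := by
  obtain ⟨j, b, b', i, k⟩ := w
  cases b <;> cases b' <;> simp [coord_U, coord_U_conj, coord_A, coord_A_conj]

lemma isInducing_configToAmbient :
    Topology.IsInducing (configToAmbient : (I → Phase d) → I → Ambient d) := by
  have h : Topology.IsInducing (toAmbient : Phase d → Ambient d) :=
    Topology.IsInducing.prodMap (f := fun U : Matrix.unitaryGroup (Fin d) ℂ => (U : Mat d))
      (g := fun A : skewAdjoint (Mat d) => (A : Mat d))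
      Topology.IsInducing.subtypeVal Topology.IsInducing.subtypeVal
  exact Topology.IsInducing.piMap fun _ => h

lemma continuous_configToAmbient :
    Continuous (configToAmbient : (I → Phase d) → I → Ambient d) :=
  isInducing_configToAmbient.continuous

lemma configToAmbient_injective :
    Function.Injective (configToAmbient : (I → Phase d) → I → Ambient d) := by
  intro z w h
  funext j
  have h1 := congrFun h j
  exact Prod.ext (Subtype.ext (congrArg Prod.fst h1)) (Subtype.ext (congrArg Prod.snd h1))

lemma isInducing_coord :
    Topology.IsInducing fun (z : I → Phase d) (w : Coord d I) => coord w (configToAmbient z) := by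
  have h : Topology.IsInducing fun (e : I → Ambient d) (w : Coord d I) => coord w e := by
    refine (Function.LeftInverse.isEmbedding (f := fun v j =>
      (fun i k => v (j, false, false, i, k), fun i k => v (j, true, false, i, k)))
      (fun e => ?_) (by fun_prop) (by fun_prop)).isInducing
    rfl
  exact h.comp isInducing_configToAmbient

/-- The labels of the monomials in a coordinate of `drivenField`. -/
abbrev Term (d : ℕ) (I : Type) : Type :=
  Fin d ⊕ Unit ⊕ I ⊕ (Fin d × Fin d) ⊕ (I × Fin d × Fin d)

/-- The monomials of the coordinates of `drivenField` at points with `U_j* U_j = 1`, where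
the `U_j`-component is `A_j U_j + P - U_j P* U_j`. -/
def termMonomial : Coord d I → Term d I → Multiset (Coord d I)
  | (_, true, _, _, _), _ => 0
  | (j, false, b, i, k), .inl l => {(j, true, b, i, l), (j, false, b, l, k)}
  | (_, false, _, _, _), .inr (.inl _) => 0
  | (_, false, b, i, k), .inr (.inr (.inl n)) => {(n, false, b, i, k)}
  | (j, false, b, i, k), .inr (.inr (.inr (.inl (l, p)))) =>
      {(j, false, b, i, l), (j, false, b, p, k)}
  | (j, false, b, i, k), .inr (.inr (.inr (.inr (n, l, p)))) =>
      {(j, false, b, i, l), (n, false, !b, p, l), (j, false, b, p, k)}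

/-- The coefficients of the monomials `termMonomial`. -/
noncomputable def termCoeff (α β : ℝ) (m : Mat d) : Coord d I → Term d I → ℂ
  | (_, true, _, _, _), _ => 0
  | (_, false, _, _, _), .inl _ => 1
  | (_, false, b, i, k), .inr (.inl _) => α * (if b then (starRingEnd ℂ) (m i k) else m i k)
  | (_, false, _, _, _), .inr (.inr (.inl _)) => β
  | (_, false, b, _, _), .inr (.inr (.inr (.inl (l, p)))) =>
      -(α * (if b then m p l else (starRingEnd ℂ) (m p l)))
  | (_, false, _, _, _), .inr (.inr (.inr (.inr _))) => -β

lemma norm_termCoeff_le (α β : ℝ) {m : Mat d} (hm : ∀ i k, ‖m i k‖ ≤ 1) (w : Coord d I)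
    (a : Term d I) : ‖termCoeff α β m w a‖ ≤ 1 + |α| + |β| := by
  have h1 : ∀ i k, |α| * ‖m i k‖ ≤ 1 + |α| + |β| := fun i k =>
    (mul_le_of_le_one_right (abs_nonneg α) (hm i k)).trans (by linarith [abs_nonneg β])
  have h2 : 0 ≤ 1 + |α| + |β| := by positivity
  obtain ⟨j, b, b', i, k⟩ := w
  cases b <;> rcases a with l | a | n | ⟨l, p⟩ | ⟨n, l, p⟩ <;> cases b' <;>
    simp [termCoeff] <;> first | exact h1 _ _ | positivity | linarith [abs_nonneg α, abs_nonneg β]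

variable [Fintype I]

lemma drive_conjTranspose_apply (α β : ℝ) (m : Mat d) (e : I → Ambient d) (l p : Fin d) :
    (drive α β m e)ᴴ l p = α * (starRingEnd ℂ) (m p l) +
      β * ∑ n, (starRingEnd ℂ) ((e n).1 p l) := by
  simp [drive, Matrix.conjTranspose_apply, Matrix.sum_apply]

/-- On unitary matrices the velocity of `U_j` is the Riccati field `A_j U_j + P - U_j P* U_j`. -/
lemma drivenField_fst (α β : ℝ) (m : Mat d) (z : I → Phase d) (j : I) (i k : Fin d) :
    (drivenField α β m (configToAmbient z) j).1 i k =
      ((z j).2 * (z j).1 + drive α β m (configToAmbient z) -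
        (z j).1 * (drive α β m (configToAmbient z))ᴴ * (z j).1 : Mat d) i k := by
  have hU : ((z j).1 : Mat d)ᴴ * (z j).1 = 1 := Matrix.mem_unitaryGroup_iff'.1 (z j).1.2
  have h : ∀ A U P : Mat d, Uᴴ * U = 1 → (A + (P * Uᴴ - U * Pᴴ)) * U = A * U + P - U * Pᴴ * U := by
    intro A U P h
    rw [add_mul, sub_mul, mul_assoc P, h, mul_one, add_sub_assoc]
  exact congrFun (congrFun (h _ _ _ hU) i) k

lemma drivenField_coord (α β : ℝ) (m : Mat d) (w : Coord d I) (z : I → Phase d) :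
    coord w (drivenField α β m (configToAmbient z)) = ∑ a, termCoeff α β m w a *
      ((termMonomial w a).map fun v => coord v (configToAmbient z)).prod := by
  obtain ⟨j, b, b', i, k⟩ := w
  cases b
  · have key : (drivenField α β m (configToAmbient z) j).1 i k =
        ∑ a, termCoeff α β m (j, false, false, i, k) a *
      ((termMonomial (j, false, false, i, k) a).map fun v => coord v (configToAmbient z)).prod := by
      rw [drivenField_fst]
      simp only [Fintype.sum_sum_type, Fintype.sum_prod_type, termCoeff, termMonomial]
      simp only [Multiset.insert_eq_cons, Multiset.map_cons, Multiset.prod_cons,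
        Multiset.map_singleton, Multiset.prod_singleton, Multiset.map_zero, Multiset.prod_zero,
        coord_U, coord_U_conj, coord_A, Bool.not_false, Matrix.sub_apply, Matrix.add_apply,
        Matrix.mul_apply, drive_conjTranspose_apply, Finset.univ_unique, Finset.sum_singleton]
      simp only [configToAmbient, toAmbient, drive, Matrix.add_apply, Matrix.smul_apply,
        Matrix.sum_apply, Matrix.of_apply, smul_eq_mul, mul_add, add_mul, Finset.sum_add_distrib,
        Finset.mul_sum, Finset.sum_mul, neg_mul, Finset.sum_neg_distrib, one_mul, mul_one]
      have e1 : ∑ p, ∑ l, ((z j).1 : Mat d) i l * (α * (starRingEnd ℂ) (m p l)) *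
          ((z j).1 : Mat d) p k = ∑ l, ∑ p, α * (starRingEnd ℂ) (m p l) *
          (((z j).1 : Mat d) i l * ((z j).1 : Mat d) p k) := by
        rw [Finset.sum_comm]
        exact Finset.sum_congr rfl fun l _ => Finset.sum_congr rfl fun p _ => by ring
      have e2 : ∑ p, ∑ l, ∑ n, ((z j).1 : Mat d) i l *
          (β * (starRingEnd ℂ) (((z n).1 : Mat d) p l)) * ((z j).1 : Mat d) p k =
          ∑ n, ∑ l, ∑ p, β * (((z j).1 : Mat d) i l *
            ((starRingEnd ℂ) (((z n).1 : Mat d) p l) * ((z j).1 : Mat d) p k)) := by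
        rw [Finset.sum_comm, Finset.sum_comm (s := (Finset.univ : Finset I))]
        refine Finset.sum_congr rfl fun l _ => ?_
        rw [Finset.sum_comm]
        exact Finset.sum_congr rfl fun l _ => Finset.sum_congr rfl fun p _ => by ring
      rw [e1, e2]
      simp only [if_false, Bool.false_eq_true]
      ring
    cases b'
    · exact key
    · rw [coord_U_conj, key, map_sum]
      refine Finset.sum_congr rfl fun a _ => ?_
      rcases a with l | a | n | ⟨l, p⟩ | ⟨n, l, p⟩ <;>
        simp [termCoeff, termMonomial, coord_U, coord_U_conj, coord_A, coord_A_conj]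
  · cases b' <;> simp [coord_A, coord_A_conj, drivenField, inU, termCoeff]

/-- The vector field of the driven system is cubic. -/
lemma isCubicField_drivenField (α β : ℝ) {M : ℝ → Mat d} (hM : ContinuousOn M (Set.Ici 0))
    (hM1 : ∀ s i k, ‖M s i k‖ ≤ 1) :
    IsCubicField (configToAmbient : (I → Phase d) → I → Ambient d)
      (fun s z => drivenField α β (M s) (configToAmbient z)) coord termMonomial
      (fun w a s => termCoeff α β (M s) w a) (1 + |α| + |β|) where
  card_le w a := by
    obtain ⟨j, b, b', i, k⟩ := w
    cases b <;> rcases a with l | a | n | ⟨l, p⟩ | ⟨n, l, p⟩ <;> simp [termMonomial]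
  continuousOn w a := by
    have hM' : ∀ i k, ContinuousOn (fun s => M s i k) (Set.Ici 0) := fun i k =>
      continuousOn_pi.1 (continuousOn_pi.1 hM i) k
    have hM'' : ∀ i k, ContinuousOn (fun s => (starRingEnd ℂ) (M s i k)) (Set.Ici 0) := fun i k =>
      Complex.continuous_conj.comp_continuousOn (hM' i k)
    obtain ⟨j, b, b', i, k⟩ := w
    cases b <;> rcases a with l | a | n | ⟨l, p⟩ | ⟨n, l, p⟩ <;> cases b' <;>
      simp only [termCoeff, if_true, if_false, Bool.false_eq_true] <;>
      first
        | exact continuousOn_const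
        | exact continuousOn_const.mul (hM' _ _)
        | exact continuousOn_const.mul (hM'' _ _)
        | exact (continuousOn_const.mul (hM' _ _)).neg
        | exact (continuousOn_const.mul (hM'' _ _)).neg
  norm_le w a s _ := norm_termCoeff_le α β (hM1 s) w a
  apply_eq w s z _ := drivenField_coord α β (M s) w z

/-! ### A cut-off in the conserved matrices `A_j` -/

/-- The `U`-components of a configuration. -/
noncomputable def projU (d : ℕ) (I : Type) [Fintype I] :
    (I → Ambient d) →L[ℝ] (I → Fin d → Fin d → ℂ) :=
  ContinuousLinearMap.pi fun j =>
    (ContinuousLinearMap.fst ℝ _ _).comp (ContinuousLinearMap.proj j)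

/-- The `A`-components of a configuration. -/
noncomputable def projA (d : ℕ) (I : Type) [Fintype I] :
    (I → Ambient d) →L[ℝ] (I → Fin d → Fin d → ℂ) :=
  ContinuousLinearMap.pi fun j =>
    (ContinuousLinearMap.snd ℝ _ _).comp (ContinuousLinearMap.proj j)

lemma norm_projU_configToAmbient_le (z : I → Phase d) : ‖projU d I (configToAmbient z)‖ ≤ 1 := by
  refine (pi_norm_le_iff_of_nonneg zero_le_one).2 fun j =>
    (pi_norm_le_iff_of_nonneg zero_le_one).2 fun i => (pi_norm_le_iff_of_nonneg zero_le_one).2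
      fun k => entry_norm_bound_of_unitary (z j).1.2 i k

lemma projA_drivenField (α β : ℝ) (m : Mat d) (e : I → Ambient d) :
    projA d I (drivenField α β m e) = 0 := rfl

/-- A bump function of the matrices `A_j`, equal to `1` on the ball of radius `r`, multiplied by
a bump function of the matrices `U_j`, equal to `1` on a neighbourhood of the unitary ones. -/
noncomputable def cutoff (d : ℕ) (I : Type) [Fintype I] {r : ℝ} (hr : 0 < r) (e : I → Ambient d) :
    ℝ :=
  (⟨2, 3, by norm_num, by norm_num⟩ : ContDiffBump (0 : I → Fin d → Fin d → ℂ)) (projU d I e) *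
    (⟨r, r + 1, hr, by linarith⟩ : ContDiffBump (0 : I → Fin d → Fin d → ℂ)) (projA d I e)

lemma cutoff_eq_one {r : ℝ} (hr : 0 < r) {e : I → Ambient d} (hU : ‖projU d I e‖ ≤ 2)
    (hA : ‖projA d I e‖ ≤ r) : cutoff d I hr e = 1 := by
  rw [cutoff, ContDiffBump.one_of_mem_closedBall _ (by simpa using hU),
    ContDiffBump.one_of_mem_closedBall _ (by simpa using hA), mul_one]

lemma norm_le_of_cutoff_ne_zero {r : ℝ} (hr : 0 < r) {e : I → Ambient d}
    (h : cutoff d I hr e ≠ 0) : ‖projU d I e‖ < 3 ∧ ‖projA d I e‖ < r + 1 := by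
  rw [cutoff, mul_ne_zero_iff] at h
  constructor
  · have := Function.mem_support.2 h.1
    rw [ContDiffBump.support_eq] at this
    simpa using this
  · have := Function.mem_support.2 h.2
    rw [ContDiffBump.support_eq] at this
    simpa using this

lemma contDiff_cutoff {r : ℝ} (hr : 0 < r) {n : ℕ∞} : ContDiff ℝ n (cutoff d I hr) :=
  ((ContDiffBump.contDiff _).comp (projU d I).contDiff).mul
    ((ContDiffBump.contDiff _).comp (projA d I).contDiff)

lemma norm_le_max_proj (e : I → Ambient d) : ‖e‖ ≤ max ‖projU d I e‖ ‖projA d I e‖ :=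
  (pi_norm_le_iff_of_nonneg (by positivity)).2 fun j =>
    max_le_max (norm_le_pi_norm (projU d I e) j) (norm_le_pi_norm (projA d I e) j)

lemma hasCompactSupport_cutoff {r : ℝ} (hr : 0 < r) : HasCompactSupport (cutoff d I hr) := by
  refine HasCompactSupport.of_support_subset_isCompact
    (isCompact_closedBall 0 (max 3 (r + 1))) fun e he => ?_
  have := norm_le_of_cutoff_ne_zero hr he
  simpa using (norm_le_max_proj e).trans (max_le_max this.1.le this.2.le)

/-- Near the unitary matrices `cutoff` is a function of the matrices `A_j` only, which do not
move. -/
lemma isCutoff_cutoff (α β : ℝ) (M : ℝ → Mat d) {r : ℝ} (hr : 0 < r) :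
    IsCutoff (configToAmbient : (I → Phase d) → I → Ambient d)
      (fun s z => drivenField α β (M s) (configToAmbient z)) coord (cutoff d I hr) (r + 1) where
  contDiff := contDiff_cutoff hr (n := 1)
  hasCompactSupport := hasCompactSupport_cutoff hr
  norm_le_one e := by
    rw [cutoff, Real.norm_eq_abs, abs_of_nonneg (mul_nonneg (ContDiffBump.nonneg _)
      (ContDiffBump.nonneg _))]
    exact mul_le_one₀ (ContDiffBump.le_one _) (ContDiffBump.nonneg _) (ContDiffBump.le_one _)
  fderiv_eq_zero s z _ := by
    set f : ContDiffBump (0 : I → Fin d → Fin d → ℂ) := ⟨r, r + 1, hr, by linarith⟩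
    have hloc : cutoff d I hr =ᶠ[nhds (configToAmbient z)] fun e => f (projA d I e) := by
      have hU : ∀ᶠ e in nhds (configToAmbient z), ‖projU d I e‖ < 2 :=
        (projU d I).continuous.norm.tendsto _ |>.eventually_lt_const
          ((norm_projU_configToAmbient_le z).trans_lt one_lt_two)
      filter_upwards [hU] with e he
      rw [cutoff, ContDiffBump.one_of_mem_closedBall _ (by simpa using he.le), one_mul]
    have hd : HasFDerivAt (fun e => f (projA d I e))
        ((fderiv ℝ f (projA d I (configToAmbient z))).comp (projA d I)) (configToAmbient z) :=
      ((f.contDiff (n := 1)).differentiable (by simp) _).hasFDerivAt.comp _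
        (projA d I).hasFDerivAt
    rw [hloc.fderiv_eq, hd.fderiv, ContinuousLinearMap.comp_apply, projA_drivenField, map_zero]
  one_le := by linarith
  norm_coord_le w z h := by
    have hA := (norm_le_of_cutoff_ne_zero hr h).2
    have hU := norm_projU_configToAmbient_le z
    have hU' : ∀ j i k, ‖(configToAmbient z j).1 i k‖ ≤ r + 1 := fun j i k =>
      ((((norm_le_pi_norm _ k).trans (norm_le_pi_norm _ i)).trans
        (norm_le_pi_norm (projU d I (configToAmbient z)) j)).trans hU).trans (by linarith)
    have hA' : ∀ j i k, ‖(configToAmbient z j).2 i k‖ ≤ r + 1 := fun j i k =>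
      (((norm_le_pi_norm _ k).trans (norm_le_pi_norm _ i)).trans
        (norm_le_pi_norm (projA d I (configToAmbient z)) j)).trans hA.le
    obtain ⟨j, b, b', i, k⟩ := w
    cases b <;> cases b' <;>
      simp only [coord_U, coord_U_conj, coord_A, coord_A_conj, RCLike.norm_conj] <;>
      first | exact hU' j i k | exact hA' j i k

/-- The continuity equation of the driven system has at most one weak solution. -/
theorem drivenField_unique [DecidableEq I] (α β : ℝ) {M : ℝ → Mat d}
    (hM : ContinuousOn M (Set.Ici 0)) (hM1 : ∀ s i k, ‖M s i k‖ ≤ 1)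
    {μ₀ : ProbabilityMeasure (I → Phase d)} {μ ν : ℝ → ProbabilityMeasure (I → Phase d)}
    (hμ : IsWeakSolution configToAmbient
      (fun s z => drivenField α β (M s) (configToAmbient z)) μ₀ μ)
    (hν : IsWeakSolution configToAmbient
      (fun s z => drivenField α β (M s) (configToAmbient z)) μ₀ ν) {t : ℝ} (ht : 0 ≤ t) :
    μ t = ν t := by
  refine IsWeakSolution.unique (q := coord) continuous_configToAmbient isInducing_coord
    (fun w => (w.1, w.2.1, !w.2.2.1, w.2.2.2)) coord_conj
    (fun n : ℕ => isCutoff_cutoff α β M (r := n + 1) (by positivity)) (fun z => ?_)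
    (isCubicField_drivenField α β hM hM1) (by positivity) hμ hν ht
  obtain ⟨n₀, hn₀⟩ := exists_nat_ge ‖projA d I (configToAmbient z)‖
  refine tendsto_const_nhds.congr' ?_
  filter_upwards [Filter.eventually_ge_atTop n₀] with n hn
  have : (n₀ : ℝ) ≤ n := by exact_mod_cast hn
  exact (cutoff_eq_one _ ((norm_projU_configToAmbient_le z).trans one_le_two)
    (by linarith)).symm

end

/-! ### The flow of the driven system -/

/-- Global existence for a bounded, uniformly Lipschitz time-dependent vector field. -/
lemma exists_global_integralCurve {E : Type*} [NormedAddCommGroup E] [NormedSpace ℝ E]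
    [CompleteSpace E] {v : ℝ → E → E} {K L : NNReal} (hK : ∀ t, LipschitzWith K (v t))
    (hc : ∀ x, Continuous fun t => v t x) (hL : ∀ t x, ‖v t x‖ ≤ L) (x₀ : E) :
    ∃ γ : ℝ → E, γ 0 = x₀ ∧ ∀ t, HasDerivAt γ (v t (γ t)) t := by
  have hloc : ∀ n : ℕ, ∃ γ : ℝ → E, γ 0 = x₀ ∧
      ∀ t ∈ Set.Ioo (-((n : ℝ) + 1)) (n + 1), HasDerivAt γ (v t (γ t)) t := by
    intro n
    have h0 : (0 : ℝ) ∈ Set.Icc (-((n : ℝ) + 1)) (n + 1) := ⟨by linarith [n.cast_nonneg (α := ℝ)],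
      by positivity⟩
    have hPL : IsPicardLindelof v (⟨0, h0⟩ : Set.Icc (-((n : ℝ) + 1)) (n + 1)) x₀
        (L * (n + 1)) 0 L K :=
      ⟨fun t _ => (hK t).lipschitzOnWith, fun x _ => (hc x).continuousOn, fun t _ x _ => hL t x,
        by simp⟩
    obtain ⟨γ, h1, h2⟩ := hPL.exists_eq_forall_mem_Icc_hasDerivWithinAt₀
    exact ⟨γ, h1, fun t ht => (h2 t (Set.Ioo_subset_Icc_self ht)).hasDerivAt
      (Icc_mem_nhds ht.1 ht.2)⟩
  choose γ hγ0 hγ using hloc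
  have hmono : ∀ n k : ℕ, n ≤ k → ∀ t ∈ Set.Ioo (-((n : ℝ) + 1)) (n + 1), γ n t = γ k t := by
    intro n k hnk
    have hnk' : (n : ℝ) ≤ k := by exact_mod_cast hnk
    refine ODE_solution_unique_of_mem_Ioo (v := v) (s := fun _ => Set.univ) (K := K) (t₀ := 0)
      (fun t _ => (hK t).lipschitzOnWith) ⟨by linarith [n.cast_nonneg (α := ℝ)], by positivity⟩
      (fun t ht => ⟨hγ n t ht, trivial⟩)
      (fun t ht => ⟨hγ k t ⟨by linarith [ht.1], by linarith [ht.2]⟩, trivial⟩) ?_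
    rw [hγ0, hγ0]
  have heq : ∀ n k : ℕ, ∀ t : ℝ, |t| < n + 1 → |t| < k + 1 → γ n t = γ k t := by
    intro n k t hn hk
    rcases le_total n k with h | h
    · exact hmono n k h t (abs_lt.1 hn)
    · exact (hmono k n h t (abs_lt.1 hk)).symm
  have hceil : ∀ t : ℝ, |t| < (⌈|t|⌉₊ : ℝ) + 1 := fun t =>
    (Nat.le_ceil _).trans_lt (lt_add_one _)
  refine ⟨fun t => γ ⌈|t|⌉₊ t, hγ0 _, fun t => ?_⟩
  refine (hγ ⌈|t|⌉₊ t (abs_lt.1 (hceil t))).congr_of_eventuallyEq ?_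
  filter_upwards [continuous_abs.tendsto t |>.eventually_lt_const (hceil t)] with s hs
  exact heq _ _ s (hceil s) hs

section

variable {d : ℕ} {I : Type} [Fintype I]

lemma contDiff_drivenField (α β : ℝ) :
    ContDiff ℝ 1 fun p : (Fin d → Fin d → ℂ) × (I → Ambient d) =>
      drivenField α β (Matrix.of p.1) p.2 := by
  have hmul : ∀ F G : (Fin d → Fin d → ℂ) × (I → Ambient d) → Mat d,
      (∀ i k, ContDiff ℝ 1 fun p => F p i k) → (∀ i k, ContDiff ℝ 1 fun p => G p i k) →
      ∀ i k, ContDiff ℝ 1 fun p => (F p * G p) i k := fun F G hF hG i k => by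
    simp only [Matrix.mul_apply]
    exact ContDiff.sum fun l _ => (hF i l).mul (hG l k)
  have hstar : ∀ F : (Fin d → Fin d → ℂ) × (I → Ambient d) → Mat d,
      (∀ i k, ContDiff ℝ 1 fun p => F p i k) → ∀ i k, ContDiff ℝ 1 fun p => (F p)ᴴ i k :=
    fun F hF i k => Complex.conjCLE.contDiff.comp (hF k i)
  have hU : ∀ j i k, ContDiff ℝ 1 fun p : (Fin d → Fin d → ℂ) × (I → Ambient d) =>
      Matrix.of (p.2 j).1 i k := fun j i k => by
    simp only [Matrix.of_apply]; fun_prop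
  have hA : ∀ j i k, ContDiff ℝ 1 fun p : (Fin d → Fin d → ℂ) × (I → Ambient d) =>
      Matrix.of (p.2 j).2 i k := fun j i k => by
    simp only [Matrix.of_apply]; fun_prop
  have hP : ∀ i k, ContDiff ℝ 1 fun p : (Fin d → Fin d → ℂ) × (I → Ambient d) =>
      drive α β (Matrix.of p.1) p.2 i k := fun i k => by
    simp only [drive, Matrix.add_apply, Matrix.smul_apply, Matrix.sum_apply, Matrix.of_apply]
    fun_prop
  refine contDiff_pi.2 fun j => ContDiff.prodMk (contDiff_pi.2 fun i => contDiff_pi.2 fun k => ?_)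
    contDiff_const
  refine hmul _ _ (fun i k => ?_) (hU j) i k
  simp only [Matrix.add_apply, Matrix.sub_apply]
  exact (hA j i k).add ((hmul _ _ hP (hstar _ (hU j)) i k).sub
    (hmul _ _ (hU j) (hstar _ hP) i k))

/-- The cut-off field is bounded and Lipschitz, uniformly for drives with entries at most `1`. -/
lemma exists_lipschitzWith_cutoff_drivenField (α β : ℝ) {r : ℝ} (hr : 0 < r) :
    ∃ K L : NNReal, ∀ m : Mat d, (∀ i k, ‖m i k‖ ≤ 1) →
      LipschitzWith K (fun e : I → Ambient d => cutoff d I hr e • drivenField α β m e) ∧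
      ∀ e : I → Ambient d, ‖cutoff d I hr e • drivenField α β m e‖ ≤ L := by
  -- a second bump function, of the drive, makes the field compactly supported in all variables
  set f : ContDiffBump (0 : Fin d → Fin d → ℂ) := ⟨1, 2, by norm_num, by norm_num⟩
  set w : (Fin d → Fin d → ℂ) × (I → Ambient d) → I → Ambient d := fun p =>
    (f p.1 * cutoff d I hr p.2) • drivenField α β (Matrix.of p.1) p.2
  have hw : ContDiff ℝ 1 w :=
    ((f.contDiff.comp contDiff_fst).mul ((contDiff_cutoff hr (n := 1)).comp contDiff_snd)).smul
      (contDiff_drivenField α β)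
  have hws : HasCompactSupport w := by
    refine HasCompactSupport.of_support_subset_isCompact
      (f.hasCompactSupport.isCompact.prod (hasCompactSupport_cutoff (d := d) (I := I) hr).isCompact)
      fun p hp => ?_
    have hp' := mul_ne_zero_iff.1 (left_ne_zero_of_smul (Function.mem_support.1 hp))
    exact ⟨subset_tsupport _ hp'.1, subset_tsupport _ hp'.2⟩
  obtain ⟨K, hK⟩ := hw.lipschitzWith_of_hasCompactSupport hws (by simp)
  obtain ⟨L, hL⟩ := hws.exists_bound_of_continuous hw.continuous
  refine ⟨K, L.toNNReal, fun m hm => ?_⟩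
  have hfm : f m = 1 := f.one_of_mem_closedBall <|
    mem_closedBall_zero_iff.2 <| (pi_norm_le_iff_of_nonneg zero_le_one).2 fun i =>
      (pi_norm_le_iff_of_nonneg zero_le_one).2 fun k => hm i k
  have hwm : ∀ e, w (m, e) = cutoff d I hr e • drivenField α β m e := fun e => by
    simp only [w, hfm, one_mul]; rfl
  constructor
  · refine LipschitzWith.of_dist_le_mul fun e e' => ?_
    rw [← hwm, ← hwm]
    refine (hK.dist_le_mul _ _).trans (le_of_eq ?_)
    rw [Prod.dist_eq, dist_self, max_eq_right dist_nonneg]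
  · intro e
    rw [← hwm]
    exact (hL _).trans (Real.le_coe_toNNReal L)

/-- A curve of configurations which solves the driven system. -/
def IsTrajectory (α β : ℝ) (M : ℝ → Mat d) (u : ℝ → I → Phase d) : Prop :=
  ∀ t, HasDerivAt (fun s => configToAmbient (u s))
    (drivenField α β (M t) (configToAmbient (u t))) t

/-- The matrices `A_j` are constant along a trajectory. -/
lemma IsTrajectory.snd_eq {α β : ℝ} {M : ℝ → Mat d} {u : ℝ → I → Phase d}
    (hu : IsTrajectory α β M u) (t : ℝ) (j : I) : (u t j).2 = (u 0 j).2 := by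
  have h : ∀ s, HasDerivAt (fun s => projA d I (configToAmbient (u s))) 0 s := fun s => by
    simpa [projA_drivenField, Function.comp_def] using
      (projA d I).hasFDerivAt.comp_hasDerivAt s (hu s)
  have := is_const_of_deriv_eq_zero (fun s => (h s).differentiableAt) (fun s => (h s).deriv) t 0
  exact Subtype.ext (congrFun this j)

/-- Existence of trajectories: the cut-off equation preserves `U_j* U_j = 1` because
`U_j' = χ S_j U_j` with `χ` real and `S_j` skew-Hermitian. -/
lemma exists_isTrajectory (α β : ℝ) {M : ℝ → Mat d} (hM : Continuous M)
    (hM1 : ∀ s i k, ‖M s i k‖ ≤ 1) (z : I → Phase d) :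
    ∃ u : ℝ → I → Phase d, u 0 = z ∧ IsTrajectory α β M u := by
  -- the `A_j` are conserved and the `U_j` remain unitary, so that the cut-off at the radius `r` is
  -- equal to `1` along the solution
  set r : ℝ := ‖projA d I (configToAmbient z)‖ + 1
  have hr : 0 < r := by positivity
  obtain ⟨K, L, hKL⟩ := exists_lipschitzWith_cutoff_drivenField (d := d) (I := I) α β hr
  obtain ⟨γ, h0, hγ⟩ := exists_global_integralCurve
    (v := fun t e => cutoff d I hr e • drivenField α β (M t) e)
    (fun t => (hKL (M t) (hM1 t)).1)
    (fun e => ((contDiff_drivenField α β).continuous.comp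
      (hM.prodMk continuous_const)).const_smul (cutoff d I hr e))
    (fun t e => (hKL (M t) (hM1 t)).2 e) (configToAmbient z)
  have hA : ∀ t, projA d I (γ t) = projA d I (configToAmbient z) := by
    have h : ∀ s, HasDerivAt (fun s => projA d I (γ s)) 0 s := fun s => by
      simpa [projA_drivenField, Function.comp_def] using
        (projA d I).hasFDerivAt.comp_hasDerivAt s (hγ s)
    intro t
    rw [← h0]
    exact is_const_of_deriv_eq_zero (fun s => (h s).differentiableAt) (fun s => (h s).deriv) t 0
  have hAj : ∀ t j, (γ t j).2 = fun i k => ((z j).2 : Mat d) i k := fun t j => congrFun (hA t) j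
  have hUd : ∀ t j i k, HasDerivAt (fun s => (γ s j).1 i k)
      (cutoff d I hr (γ t) • (drivenField α β (M t) (γ t) j).1 i k) t := fun t j i k =>
    (coord (j, false, false, i, k)).hasFDerivAt.comp_hasDerivAt t (hγ t)
  have hU : ∀ t j, (Matrix.of (γ t j).1)ᴴ * Matrix.of (γ t j).1 = (1 : Mat d) := by
    intro t j
    ext i k
    have hd : ∀ s, HasDerivAt (fun s => ((Matrix.of (γ s j).1)ᴴ * Matrix.of (γ s j).1 : Mat d) i k)
        0 s := by
      intro s
      set U : Mat d := Matrix.of (γ s j).1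
      set S : Mat d := Matrix.of (γ s j).2 + (drive α β (M s) (γ s) * Uᴴ -
        U * (drive α β (M s) (γ s))ᴴ)
      have hS : Sᴴ = -S := by
        have h1 : (Matrix.of (γ s j).2)ᴴ = -(Matrix.of (γ s j).2 : Mat d) := by
          rw [hAj]; exact (z j).2.2
        simp only [S, Matrix.conjTranspose_add, Matrix.conjTranspose_sub,
          Matrix.conjTranspose_mul, Matrix.conjTranspose_conjTranspose, h1]
        abel
      simp only [Matrix.mul_apply, Matrix.conjTranspose_apply, Matrix.of_apply]
      have h2 := HasDerivAt.fun_sum (u := Finset.univ) fun l _ =>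
        ((hUd s j l i).star).mul (hUd s j l k)
      refine h2.congr_deriv ?_
      have h3 : ((S * U)ᴴ * U + Uᴴ * (S * U)) i k = 0 := by
        rw [Matrix.conjTranspose_mul, hS, mul_neg, neg_mul, mul_assoc, neg_add_cancel]; rfl
      simp only [Matrix.add_apply, Matrix.mul_apply (M := (S * U)ᴴ),
        Matrix.mul_apply (M := Uᴴ), Matrix.conjTranspose_apply] at h3
      rw [← mul_zero ((cutoff d I hr (γ s) : ℝ) : ℂ), ← h3, ← Finset.sum_add_distrib,
        Finset.mul_sum]
      refine Finset.sum_congr rfl fun l _ => ?_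
      have h4 : ∀ i, (drivenField α β (M s) (γ s) j).1 l i = (S * U) l i := fun _ => rfl
      rw [h4, h4]
      simp only [U, Matrix.of_apply, Complex.real_smul, star_mul']
      simp
      ring
    have h1 := is_const_of_deriv_eq_zero (fun s => (hd s).differentiableAt)
      (fun s => (hd s).deriv) t 0
    rw [h1, h0]
    have : ((z j).1 : Mat d)ᴴ * (z j).1 = 1 := Matrix.mem_unitaryGroup_iff'.1 (z j).1.2
    exact congrFun (congrFun this i) k
  set u : ℝ → I → Phase d := fun t j =>
    (⟨Matrix.of (γ t j).1, Matrix.mem_unitaryGroup_iff'.2 (hU t j)⟩, (z j).2)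
  have hu : ∀ t, configToAmbient (u t) = γ t := fun t =>
    funext fun j => Prod.ext rfl (hAj t j).symm
  refine ⟨u, configToAmbient_injective (by rw [hu, h0]), fun t => ?_⟩
  simp only [hu]
  have h1 : cutoff d I hr (γ t) = 1 := cutoff_eq_one hr
    ((by rw [← hu]; exact norm_projU_configToAmbient_le _ : _ ≤ (1 : ℝ)).trans one_le_two)
    (by rw [hA]; exact le_add_of_nonneg_right zero_le_one)
  simpa [h1] using hγ t

/-- Trajectories whose matrices `A_j` are bounded by `r` depend Lipschitz continuously on the
initial configuration. -/
lemma exists_dist_trajectory_le (α β : ℝ) {M : ℝ → Mat d}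
    (hM1 : ∀ s i k, ‖M s i k‖ ≤ 1) {r : ℝ} (hr : 0 < r) :
    ∃ K : ℝ, ∀ u w : ℝ → I → Phase d, IsTrajectory α β M u → IsTrajectory α β M w →
      ‖projA d I (configToAmbient (u 0))‖ ≤ r → ‖projA d I (configToAmbient (w 0))‖ ≤ r →
      ∀ t, 0 ≤ t → dist (configToAmbient (u t)) (configToAmbient (w t)) ≤
        dist (configToAmbient (u 0)) (configToAmbient (w 0)) * Real.exp (K * t) := by
  obtain ⟨K, L, hKL⟩ := exists_lipschitzWith_cutoff_drivenField (d := d) (I := I) α β hr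
  refine ⟨K, fun u w hu hw hur hwr t ht => ?_⟩
  have key : ∀ u : ℝ → I → Phase d, IsTrajectory α β M u →
      ‖projA d I (configToAmbient (u 0))‖ ≤ r → ∀ t,
      HasDerivAt (fun s => configToAmbient (u s)) (cutoff d I hr (configToAmbient (u t)) •
        drivenField α β (M t) (configToAmbient (u t))) t := by
    intro u hu hur t
    have hA : projA d I (configToAmbient (u t)) = projA d I (configToAmbient (u 0)) := by
      funext j
      exact congrArg (fun A : skewAdjoint (Mat d) => fun i k => (A : Mat d) i k) (hu.snd_eq t j)
    rw [cutoff_eq_one hr ((norm_projU_configToAmbient_le _).trans one_le_two) (by rwa [hA]),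
      one_smul]
    exact hu t
  simpa using dist_le_of_trajectories_ODE
    (v := fun t e => cutoff d I hr e • drivenField α β (M t) e) (a := 0) (b := t)
    (fun t => (hKL (M t) (hM1 t)).1)
    (fun s _ => (hu s).continuousAt.continuousWithinAt)
    (fun s _ => (key u hu hur s).hasDerivWithinAt)
    (fun s _ => (hw s).continuousAt.continuousWithinAt)
    (fun s _ => (key w hw hwr s).hasDerivWithinAt) le_rfl t ⟨ht, le_rfl⟩

/-- The flow of the driven system from time `0`. -/
structure IsFlow (α β : ℝ) (M : ℝ → Mat d) (Φ : ℝ → (I → Phase d) → I → Phase d) : Prop where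
  zero : ∀ z, Φ 0 z = z
  isTrajectory : ∀ z, IsTrajectory α β M fun t => Φ t z
  continuous : ∀ t, 0 ≤ t → Continuous (Φ t)
  eq_of_isTrajectory : ∀ u, IsTrajectory α β M u → ∀ t, 0 ≤ t → u t = Φ t (u 0)

theorem exists_isFlow (I : Type) [Fintype I] (α β : ℝ) {M : ℝ → Mat d} (hM : Continuous M)
    (hM1 : ∀ s i k, ‖M s i k‖ ≤ 1) :
    ∃ Φ : ℝ → (I → Phase d) → I → Phase d, IsFlow α β M Φ := by
  choose u hu0 hu using exists_isTrajectory (I := I) α β hM hM1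
  refine ⟨fun t z => u z t, hu0, hu, fun t ht => ?_, fun w hw t ht => ?_⟩
  · rw [isInducing_configToAmbient.continuous_iff]
    refine continuous_iff_continuousAt.2 fun z => ?_
    set r : ℝ := ‖projA d I (configToAmbient z)‖ + 1
    obtain ⟨K, hK⟩ := exists_dist_trajectory_le (I := I) α β hM1 (r := r) (by positivity)
    have hev : ∀ᶠ y in nhds z, ‖projA d I (configToAmbient y)‖ < r :=
      (((projA d I).continuous.comp continuous_configToAmbient).norm.tendsto z).eventually_lt_const
        (lt_add_one _)
    refine tendsto_iff_dist_tendsto_zero.2 (squeeze_zero' (Filter.Eventually.of_forall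
      fun _ => dist_nonneg) (g := fun y => dist (configToAmbient y) (configToAmbient z) *
        Real.exp (K * t)) ?_ ?_)
    · filter_upwards [hev] with y hy
      simpa [hu0] using hK (u y) (u z) (hu y) (hu z) (by rw [hu0]; exact hy.le)
        (by rw [hu0]; exact le_add_of_nonneg_right zero_le_one) t ht
    · simpa using ((tendsto_iff_dist_tendsto_zero.1
        (continuous_configToAmbient.tendsto z)).mul_const (Real.exp (K * t)))
  · obtain ⟨K, hK⟩ := exists_dist_trajectory_le (I := I) α β hM1
      (r := ‖projA d I (configToAmbient (w 0))‖ + 1) (by positivity)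
    have := hK w (u (w 0)) hw (hu _) (by simp) (by simp [hu0]) t ht
    rw [hu0, dist_self, zero_mul] at this
    exact configToAmbient_injective (dist_le_zero.1 this)

end

/-! ### Weak solutions are transported by the flow -/

lemma IsWeakSolution.congr {X E : Type} [TopologicalSpace X] [MeasurableSpace X]
    [OpensMeasurableSpace X] [NormedAddCommGroup E] [NormedSpace ℝ E] {ι : X → E}
    {b b' : ℝ → X → E} {μ₀ : ProbabilityMeasure X} {μ : ℝ → ProbabilityMeasure X}
    (h : IsWeakSolution ι b μ₀ μ) (hb : ∀ s x, 0 ≤ s → b s x = b' s x) :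
    IsWeakSolution ι b' μ₀ μ where
  continuousOn := h.continuousOn
  initial := h.initial
  weak φ h1 h2 t ht := by
    rw [h.weak φ h1 h2 t ht]
    congr 1
    refine intervalIntegral.integral_congr fun s hs => ?_
    rw [Set.uIcc_of_le ht] at hs
    simp only [hb s _ hs.1]

section

variable {d : ℕ} {I : Type} [Fintype I] {α β : ℝ} {M : ℝ → Mat d}
  {Φ : ℝ → (I → Phase d) → I → Phase d}

lemma IsFlow.continuous_time (h : IsFlow α β M Φ) (z : I → Phase d) :
    Continuous fun t => Φ t z := by
  rw [isInducing_configToAmbient.continuous_iff]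
  exact continuous_iff_continuousAt.2 fun t => (h.isTrajectory z t).continuousAt

/-- The image of a probability measure under the flow. For `t < 0` the value is irrelevant. -/
noncomputable def flowLaw (h : IsFlow α β M Φ) (μ₀ : ProbabilityMeasure (I → Phase d)) (t : ℝ) :
    ProbabilityMeasure (I → Phase d) :=
  μ₀.map (f := Φ (max t 0)) (h.continuous _ (le_max_right _ _)).measurable.aemeasurable

lemma integral_flowLaw (h : IsFlow α β M Φ) (μ₀ : ProbabilityMeasure (I → Phase d)) {t : ℝ}
    (ht : 0 ≤ t) {g : (I → Phase d) → ℝ} (hg : Continuous g) :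
    ∫ z, g z ∂(flowLaw h μ₀ t : Measure (I → Phase d)) =
      ∫ z, g (Φ t z) ∂(μ₀ : Measure (I → Phase d)) := by
  have : (flowLaw h μ₀ t : Measure (I → Phase d)) = (μ₀ : Measure (I → Phase d)).map (Φ t) := by
    simp only [flowLaw, ProbabilityMeasure.toMeasure_map, max_eq_left ht]
  rw [this, integral_map (h.continuous t ht).measurable.aemeasurable hg.aestronglyMeasurable]

lemma exists_bound_fderiv_drivenField (α β : ℝ) {φ : (I → Ambient d) → ℝ} (h1 : ContDiff ℝ 1 φ)
    (h2 : HasCompactSupport φ) : ∃ K : ℝ, ∀ m : Mat d, (∀ i k, ‖m i k‖ ≤ 1) → ∀ e,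
      ‖fderiv ℝ φ e (drivenField α β m e)‖ ≤ K := by
  have hc : Continuous fun p : (Fin d → Fin d → ℂ) × (I → Ambient d) =>
      fderiv ℝ φ p.2 (drivenField α β (Matrix.of p.1) p.2) :=
    ((h1.continuous_fderiv (by simp)).comp continuous_snd).clm_apply
      (contDiff_drivenField α β).continuous
  obtain ⟨K, hK⟩ := ((isCompact_closedBall (0 : Fin d → Fin d → ℂ) 1).prod
    h2.isCompact).exists_bound_of_continuousOn hc.continuousOn
  refine ⟨max K 0, fun m hm e => ?_⟩
  by_cases he : e ∈ tsupport φ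
  · refine (hK (m, e) ⟨?_, he⟩).trans (le_max_left _ _)
    exact mem_closedBall_zero_iff.2 <| (pi_norm_le_iff_of_nonneg zero_le_one).2 fun i =>
      (pi_norm_le_iff_of_nonneg zero_le_one).2 fun k => hm i k
  · have : fderiv ℝ φ e = 0 := by
      by_contra h
      exact he (support_fderiv_subset ℝ (Function.mem_support.2 h))
    rw [this]; simp

lemma continuousOn_flowLaw (h : IsFlow α β M Φ) (μ₀ : ProbabilityMeasure (I → Phase d)) :
    ContinuousOn (flowLaw h μ₀) (Set.Ici 0) := by
  intro t ht
  refine ProbabilityMeasure.tendsto_iff_forall_integral_tendsto.2 fun g => ?_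
  have heq : ∀ᶠ s in nhdsWithin t (Set.Ici 0), ∫ z, g (Φ s z) ∂(μ₀ : Measure (I → Phase d)) =
      ∫ z, g z ∂(flowLaw h μ₀ s : Measure (I → Phase d)) := by
    filter_upwards [self_mem_nhdsWithin] with s hs
    exact (integral_flowLaw h μ₀ hs g.continuous).symm
  rw [integral_flowLaw h μ₀ ht g.continuous]
  refine Filter.Tendsto.congr' heq ?_
  refine tendsto_integral_filter_of_dominated_convergence (fun _ => ‖g‖) ?_ ?_
    (integrable_const _) ?_
  · filter_upwards [self_mem_nhdsWithin] with s hs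
    exact (g.continuous.comp (h.continuous s hs)).aestronglyMeasurable
  · exact Filter.Eventually.of_forall fun s => Filter.Eventually.of_forall fun z =>
      g.norm_coe_le_norm _
  · exact Filter.Eventually.of_forall fun z =>
      ((g.continuous.comp (h.continuous_time z)).tendsto t).mono_left nhdsWithin_le_nhds

lemma flowLaw_zero (h : IsFlow α β M Φ) (μ₀ : ProbabilityMeasure (I → Phase d)) :
    flowLaw h μ₀ 0 = μ₀ := by
  refine Subtype.ext ?_
  have : Φ (max 0 0) = id := funext fun z => by rw [max_self]; exact h.zero z
  simp only [flowLaw, ProbabilityMeasure.val_eq_to_measure, ProbabilityMeasure.toMeasure_map,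
    this, Measure.map_id]

lemma integral_flowLaw_eq (hM : Continuous M) (hM1 : ∀ s i k, ‖M s i k‖ ≤ 1)
    (h : IsFlow α β M Φ) (μ₀ : ProbabilityMeasure (I → Phase d)) {φ : (I → Ambient d) → ℝ}
    (h1 : ContDiff ℝ 1 φ) (h2 : HasCompactSupport φ) {t : ℝ} (ht : 0 ≤ t) :
    ∫ z, φ (configToAmbient z) ∂(flowLaw h μ₀ t : Measure (I → Phase d)) =
      ∫ z, φ (configToAmbient z) ∂(μ₀ : Measure (I → Phase d)) +
      ∫ s in (0 : ℝ)..t, ∫ z, fderiv ℝ φ (configToAmbient z)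
        (drivenField α β (M s) (configToAmbient z))
          ∂(flowLaw h μ₀ s : Measure (I → Phase d)) := by
  set g : ℝ → (I → Phase d) → ℝ := fun s z => fderiv ℝ φ (configToAmbient (Φ s z))
    (drivenField α β (M s) (configToAmbient (Φ s z))) with hg
  obtain ⟨K, hK⟩ := exists_bound_fderiv_drivenField (d := d) (I := I) α β h1 h2
  have hfield : Continuous fun p : ℝ × (I → Ambient d) =>
      fderiv ℝ φ p.2 (drivenField α β (M p.1) p.2) := by
    have e1 : Continuous fun p : ℝ × (I → Ambient d) => fderiv ℝ φ p.2 :=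
      (h1.continuous_fderiv (by simp)).comp continuous_snd
    have e2 : Continuous fun p : ℝ × (I → Ambient d) =>
        ((M p.1, p.2) : (Fin d → Fin d → ℂ) × (I → Ambient d)) :=
      (hM.comp continuous_fst).prodMk continuous_snd
    have e3 : Continuous fun p : ℝ × (I → Ambient d) => drivenField α β (M p.1) p.2 :=
      ((contDiff_drivenField α β).continuous.comp e2).congr fun p => rfl
    exact e1.clm_apply e3
  have hgt : ∀ z, Continuous fun s => g s z := fun z =>
    hfield.comp (continuous_id.prodMk (continuous_configToAmbient.comp (h.continuous_time z)))
  have hgz : ∀ s, 0 ≤ s → Continuous (g s) := fun s hs =>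
    hfield.comp (continuous_const.prodMk (continuous_configToAmbient.comp (h.continuous s hs)))
  have hFTC : ∀ z, ∫ s in (0 : ℝ)..t, g s z =
      φ (configToAmbient (Φ t z)) - φ (configToAmbient z) := by
    intro z
    have hd : ∀ s ∈ Set.uIcc 0 t, HasDerivAt (fun s => φ (configToAmbient (Φ s z))) (g s z) s :=
      fun s _ => ((h1.differentiable (by simp)) _).hasFDerivAt.comp_hasDerivAt s
        (h.isTrajectory z s)
    rw [intervalIntegral.integral_eq_sub_of_hasDerivAt hd ((hgt z).intervalIntegrable _ _),
      h.zero]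
  have hmeas : StronglyMeasurable (Function.uncurry fun s z => g (max s 0) z) :=
    stronglyMeasurable_uncurry_of_continuous_of_stronglyMeasurable
      (fun z => (hgt z).comp (continuous_id.max continuous_const))
      (fun s => (hgz _ (le_max_right s 0)).stronglyMeasurable)
  have hφ : Continuous fun z : I → Phase d => φ (configToAmbient z) :=
    h1.continuous.comp continuous_configToAmbient
  obtain ⟨B, hB⟩ := h2.exists_bound_of_continuous h1.continuous
  have hi : Integrable (fun z => φ (configToAmbient z)) (μ₀ : Measure (I → Phase d)) :=
    Integrable.of_bound hφ.aestronglyMeasurable B (Filter.Eventually.of_forall fun z => hB _)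
  have hit : Integrable (fun z => φ (configToAmbient (Φ t z))) (μ₀ : Measure (I → Phase d)) :=
    Integrable.of_bound (hφ.comp (h.continuous t ht)).aestronglyMeasurable B
      (Filter.Eventually.of_forall fun z => hB _)
  have hswap : ∫ s in (0 : ℝ)..t, ∫ z, g s z ∂(μ₀ : Measure (I → Phase d)) =
      ∫ z, (∫ s in (0 : ℝ)..t, g s z) ∂(μ₀ : Measure (I → Phase d)) := by
    have e1 : ∫ s in (0 : ℝ)..t, ∫ z, g s z ∂(μ₀ : Measure (I → Phase d)) =
        ∫ s in (0 : ℝ)..t, ∫ z, g (max s 0) z ∂(μ₀ : Measure (I → Phase d)) :=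
      intervalIntegral.integral_congr fun s hs => by
        rw [Set.uIcc_of_le ht] at hs; simp only [max_eq_left hs.1]
    have e2 : ∀ z, ∫ s in (0 : ℝ)..t, g s z = ∫ s in (0 : ℝ)..t, g (max s 0) z := fun z =>
      intervalIntegral.integral_congr fun s hs => by
        rw [Set.uIcc_of_le ht] at hs; simp only [max_eq_left hs.1]
    simp only [e1, e2, intervalIntegral.integral_of_le ht]
    have hbd : ∀ p : ℝ × (I → Phase d), ‖Function.uncurry (fun s z => g (max s 0) z) p‖ ≤ K :=
      fun p => hK _ (hM1 _) _
    have hI : Integrable (Function.uncurry fun s z => g (max s 0) z)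
        ((volume.restrict (Set.Ioc 0 t)).prod (μ₀ : Measure (I → Phase d))) :=
      Integrable.of_bound hmeas.aestronglyMeasurable K (Filter.Eventually.of_forall hbd)
    exact integral_integral_swap hI
  have hlaw : ∀ s ∈ Set.uIcc 0 t, ∫ z, fderiv ℝ φ (configToAmbient z)
      (drivenField α β (M s) (configToAmbient z)) ∂(flowLaw h μ₀ s : Measure (I → Phase d)) =
      ∫ z, g s z ∂(μ₀ : Measure (I → Phase d)) := by
    intro s hs
    rw [Set.uIcc_of_le ht] at hs
    exact integral_flowLaw h μ₀ hs.1
      (hfield.comp (continuous_const.prodMk continuous_configToAmbient))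
  rw [intervalIntegral.integral_congr hlaw, hswap, integral_flowLaw h μ₀ ht hφ]
  simp only [hFTC]
  rw [integral_sub hit hi]
  ring

/-- The law of the flow is a weak solution. -/
theorem isWeakSolution_flowLaw (hM : Continuous M) (hM1 : ∀ s i k, ‖M s i k‖ ≤ 1)
    (h : IsFlow α β M Φ) (μ₀ : ProbabilityMeasure (I → Phase d)) :
    IsWeakSolution configToAmbient (fun s z => drivenField α β (M s) (configToAmbient z)) μ₀
      (flowLaw h μ₀) where
  continuousOn := continuousOn_flowLaw h μ₀
  initial := flowLaw_zero h μ₀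
  weak _ h1 h2 _ ht := integral_flowLaw_eq hM hM1 h μ₀ h1 h2 ht

/-- Every weak solution is the image of its initial datum under the flow. -/
theorem IsFlow.map_eq_of_isWeakSolution (hM : Continuous M) (hM1 : ∀ s i k, ‖M s i k‖ ≤ 1)
    (h : IsFlow α β M Φ) {μ₀ : ProbabilityMeasure (I → Phase d)}
    {μ : ℝ → ProbabilityMeasure (I → Phase d)} (hμ : IsWeakSolution configToAmbient
      (fun s z => drivenField α β (M s) (configToAmbient z)) μ₀ μ) {t : ℝ} (ht : 0 ≤ t) :
    (μ t : Measure (I → Phase d)) = (μ₀ : Measure (I → Phase d)).map (Φ t) := by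
  classical
  rw [drivenField_unique α β hM.continuousOn hM1 hμ (isWeakSolution_flowLaw hM hM1 h μ₀) ht]
  simp only [flowLaw, ProbabilityMeasure.toMeasure_map, max_eq_left ht]

end

/-! ### The Frobenius inner product and the dissipation inequality -/

section

variable {d : ℕ}

/-- The real inner product `Re trace (A* B)` of matrices. -/
def frobInner (A B : Mat d) : ℝ := ∑ i, ∑ j, ((starRingEnd ℂ) (A i j) * B i j).re

lemma frobInner_eq_trace (A B : Mat d) : frobInner A B = (Aᴴ * B).trace.re := by
  simp only [frobInner, Matrix.trace, Matrix.diag_apply, Matrix.mul_apply,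
    Matrix.conjTranspose_apply, Complex.re_sum]
  rw [Finset.sum_comm]
  rfl

lemma frobSq_eq_frobInner (A : Mat d) : frobSq A = frobInner A A := by
  simp only [frobSq, frobInner, ← Complex.normSq_eq_norm_sq, ← Complex.normSq_eq_conj_mul_self,
    Complex.ofReal_re]

lemma frobSq_nonneg (A : Mat d) : 0 ≤ frobSq A := by unfold frobSq; positivity

lemma frobInner_add_right (A B C : Mat d) :
    frobInner A (B + C) = frobInner A B + frobInner A C := by
  simp [frobInner_eq_trace, mul_add]

lemma frobInner_sub_right (A B C : Mat d) :
    frobInner A (B - C) = frobInner A B - frobInner A C := by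
  simp [frobInner_eq_trace, mul_sub]

lemma frobInner_smul_right (c : ℝ) (A B : Mat d) :
    frobInner A ((c : ℂ) • B) = c * frobInner A B := by
  simp [frobInner_eq_trace]

lemma frobInner_mul_right (A Z V : Mat d) : frobInner A (Z * V) = frobInner (A * Vᴴ) Z := by
  rw [frobInner_eq_trace, frobInner_eq_trace, Matrix.conjTranspose_mul,
    Matrix.conjTranspose_conjTranspose, ← mul_assoc, Matrix.trace_mul_comm, mul_assoc]

lemma frobInner_skew_mul_self {S : Mat d} (hS : Sᴴ = -S) (A : Mat d) :
    frobInner A (S * A) = 0 := by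
  have h : star (Aᴴ * (S * A)).trace = -(Aᴴ * (S * A)).trace := by
    rw [← Matrix.trace_conjTranspose, Matrix.conjTranspose_mul, Matrix.conjTranspose_mul, hS,
      Matrix.conjTranspose_conjTranspose, mul_assoc, neg_mul, mul_neg, Matrix.trace_neg]
  have h1 := congrArg Complex.re h
  rw [frobInner_eq_trace]
  simp at h1
  linarith

lemma frobSq_conjTranspose (A : Mat d) : frobSq Aᴴ = frobSq A := by
  rw [frobSq_eq_frobInner, frobSq_eq_frobInner, frobInner_eq_trace, frobInner_eq_trace,
    Matrix.conjTranspose_conjTranspose, Matrix.trace_mul_comm]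

lemma frobSq_unitary_mul {U : Mat d} (hU : Uᴴ * U = 1) (A : Mat d) : frobSq (U * A) = frobSq A := by
  rw [frobSq_eq_frobInner, frobSq_eq_frobInner, frobInner_eq_trace, frobInner_eq_trace,
    Matrix.conjTranspose_mul, mul_assoc, ← mul_assoc Uᴴ, hU, one_mul]

lemma frobSq_mul_conjTranspose {U : Mat d} (hU : Uᴴ * U = 1) (A : Mat d) :
    frobSq (A * Uᴴ) = frobSq A := by
  rw [← frobSq_conjTranspose, Matrix.conjTranspose_mul, Matrix.conjTranspose_conjTranspose,
    frobSq_unitary_mul hU, frobSq_conjTranspose]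

lemma frobSq_unitary (U : Matrix.unitaryGroup (Fin d) ℂ) : frobSq (U : Mat d) = d := by
  have hU : (U : Mat d)ᴴ * U = 1 := Matrix.mem_unitaryGroup_iff'.1 U.2
  rw [frobSq_eq_frobInner, frobInner_eq_trace, hU]
  simp

lemma abs_frobInner_le {ε : ℝ} (hε : 0 < ε) (A B : Mat d) :
    |frobInner A B| ≤ ε / 2 * frobSq A + 1 / (2 * ε) * frobSq B := by
  simp only [frobInner, frobSq, Finset.mul_sum, ← Finset.sum_add_distrib]
  refine (Finset.abs_sum_le_sum_abs _ _).trans (Finset.sum_le_sum fun i _ =>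
    (Finset.abs_sum_le_sum_abs _ _).trans (Finset.sum_le_sum fun j _ => ?_))
  refine (Complex.abs_re_le_norm _).trans ?_
  rw [norm_mul, RCLike.norm_conj]
  have h : ε / 2 * ‖A i j‖ ^ 2 + 1 / (2 * ε) * ‖B i j‖ ^ 2 - ‖A i j‖ * ‖B i j‖ =
      (ε * ‖A i j‖ - ‖B i j‖) ^ 2 / (2 * ε) := by field_simp; ring
  have : 0 ≤ (ε * ‖A i j‖ - ‖B i j‖) ^ 2 / (2 * ε) := by positivity
  linarith

/-- Jensen's inequality for `frobSq` and an arithmetic mean. -/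
lemma frobSq_mean_le {N : ℕ} (hN : 0 < N) (X : Fin N → Mat d) :
    frobSq (((1 / N : ℝ) : ℂ) • ∑ k, X k) ≤ 1 / N * ∑ k, frobSq (X k) := by
  have hN' : (0 : ℝ) < N := by exact_mod_cast hN
  have h : 1 / (N : ℝ) * ∑ k, frobSq (X k) = ∑ i, ∑ j, 1 / (N : ℝ) * ∑ k, ‖X k i j‖ ^ 2 := by
    simp only [frobSq]
    rw [Finset.sum_comm, Finset.mul_sum]
    refine Finset.sum_congr rfl fun i _ => ?_
    rw [Finset.sum_comm, Finset.mul_sum]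
  rw [h]
  refine Finset.sum_le_sum fun i _ => Finset.sum_le_sum fun j _ => ?_
  rw [Matrix.smul_apply, Matrix.sum_apply, smul_eq_mul, norm_mul, Complex.norm_real, mul_pow]
  have h1 : ‖∑ k, X k i j‖ ^ 2 ≤ N * ∑ k, ‖X k i j‖ ^ 2 :=
    (pow_le_pow_left₀ (norm_nonneg _) (norm_sum_le _ _) 2).trans (by
      simpa using sq_sum_le_card_mul_sum_sq (s := Finset.univ) (f := fun k => ‖X k i j‖))
  calc ‖(1 / N : ℝ)‖ ^ 2 * ‖∑ k, X k i j‖ ^ 2 ≤ ‖(1 / N : ℝ)‖ ^ 2 * (N * ∑ k, ‖X k i j‖ ^ 2) := by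
        gcongr
    _ = 1 / N * ∑ k, ‖X k i j‖ ^ 2 := by
        rw [Real.norm_eq_abs, sq_abs]; field_simp

/-- The common skew-Hermitian part of the two velocities does not contribute to the growth of
`‖U - V‖²`. -/
lemma frobInner_velocity_sub {A U V : Mat d} (hA : Aᴴ = -A) (P Q : Mat d) :
    frobInner (U - V) ((A + (P * Uᴴ - U * Pᴴ)) * U - (A + (Q * Vᴴ - V * Qᴴ)) * V) =
      frobInner ((U - V) * Vᴴ) ((P * Uᴴ - U * Pᴴ) - (Q * Vᴴ - V * Qᴴ)) := by
  have hS : (A + (P * Uᴴ - U * Pᴴ))ᴴ = -(A + (P * Uᴴ - U * Pᴴ)) := by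
    simp only [Matrix.conjTranspose_add, Matrix.conjTranspose_sub, Matrix.conjTranspose_mul,
      Matrix.conjTranspose_conjTranspose, hA]
    abel
  have h : (A + (P * Uᴴ - U * Pᴴ)) * U - (A + (Q * Vᴴ - V * Qᴴ)) * V =
      (A + (P * Uᴴ - U * Pᴴ)) * (U - V) + ((P * Uᴴ - U * Pᴴ) - (Q * Vᴴ - V * Qᴴ)) * V := by
    noncomm_ring
  rw [h, frobInner_add_right, frobInner_skew_mul_self hS, zero_add, frobInner_mul_right]

/-- The contribution of one oscillator to the dissipation inequality. The interaction splits into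
a part due to the difference of the empirical means `Ū - V̄`, a part due to `U - V`, and the
fluctuation `V̄ - m` of the empirical mean. -/
lemma frobInner_coupling_le {U V Ub Vb m : Mat d} (hU : Uᴴ * U = 1) (hV : Vᴴ * V = 1)
    (hVb : ∀ X : Mat d, frobSq (Vb * X) ≤ frobSq X) :
    frobInner ((U - V) * Vᴴ) ((Ub * Uᴴ - U * Ubᴴ) - (m * Vᴴ - V * mᴴ)) ≤
      7 / 2 * frobSq (U - V) + frobSq (Ub - Vb) + 2 * frobSq (Vb - m) := by
  set W := (U - V) * Vᴴ
  have hW : frobSq W = frobSq (U - V) := frobSq_mul_conjTranspose hV _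
  set Z₁ := (Ub - Vb) * Uᴴ
  set Z₂ := Vb * (U - V)ᴴ
  set Z₃ := (Vb - m) * Vᴴ
  -- `Z₁ + Z₂ + Z₃ = Ū U* - m V*`
  have hsplit : (Ub * Uᴴ - U * Ubᴴ) - (m * Vᴴ - V * mᴴ) =
      (Z₁ + Z₂ + Z₃) - (Z₁ᴴ + Z₂ᴴ + Z₃ᴴ) := by
    simp only [Z₁, Z₂, Z₃, Matrix.conjTranspose_mul, Matrix.conjTranspose_sub,
      Matrix.conjTranspose_conjTranspose]
    noncomm_ring
  have e1 : frobSq Z₁ = frobSq (Ub - Vb) := frobSq_mul_conjTranspose hU _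
  have e2 : frobSq Z₂ ≤ frobSq (U - V) := (hVb _).trans_eq (frobSq_conjTranspose _)
  have e3 : frobSq Z₃ = frobSq (Vb - m) := frobSq_mul_conjTranspose hV _
  have b1 := abs_le.1 (abs_frobInner_le one_pos W Z₁)
  have b1' := abs_le.1 (abs_frobInner_le one_pos W Z₁ᴴ)
  have b2 := abs_le.1 (abs_frobInner_le one_pos W Z₂)
  have b2' := abs_le.1 (abs_frobInner_le one_pos W Z₂ᴴ)
  -- Young's inequality with weight `1 / 2`, so that the fluctuation appears with the factor `2`
  have b3 := abs_le.1 (abs_frobInner_le one_half_pos W Z₃)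
  have b3' := abs_le.1 (abs_frobInner_le one_half_pos W Z₃ᴴ)
  rw [frobSq_conjTranspose] at b1' b2' b3'
  rw [hW] at b1 b1' b2 b2' b3 b3'
  rw [hsplit, frobInner_sub_right, frobInner_add_right, frobInner_add_right, frobInner_add_right,
    frobInner_add_right]
  norm_num at b1 b1' b2 b2' b3 b3'
  linarith [b1.2, b1'.1, b2.2, b2'.1, b3.2, b3'.1]

lemma hasDerivAt_frobSq {D D' : ℝ → Mat d} {t : ℝ}
    (h : ∀ i j, HasDerivAt (fun s => D s i j) (D' t i j) t) :
    HasDerivAt (fun s => frobSq (D s)) (2 * frobInner (D t) (D' t)) t := by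
  simp only [frobSq, frobInner, Finset.mul_sum]
  refine HasDerivAt.fun_sum fun i _ => HasDerivAt.fun_sum fun j _ => ?_
  refine (h i j).norm_sq.congr_deriv ?_
  rw [Complex.inner, mul_comm (D' t i j)]

end

/-! ### Grönwall's inequality and the fluctuation of an empirical mean -/

/-- Grönwall's inequality with a time-dependent source. -/
lemma le_integral_of_deriv_le {x x' g : ℝ → ℝ} {a : ℝ} (hx : ∀ s, HasDerivAt x (x' s) s)
    (hg : Continuous g) (h0 : x 0 = 0) {t : ℝ} (ht : 0 ≤ t)
    (hle : ∀ s, 0 ≤ s → x' s ≤ a * x s + g s) :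
    x t ≤ ∫ s in (0 : ℝ)..t, Real.exp (a * (t - s)) * g s := by
  have hd : ∀ s, HasDerivAt (fun s => Real.exp (a * (t - s)) * x s)
      (Real.exp (a * (t - s)) * (x' s - a * x s)) s := by
    intro s
    have h1 : HasDerivAt (fun s => Real.exp (a * (t - s))) (Real.exp (a * (t - s)) * (-a)) s := by
      have := (((hasDerivAt_id s).const_sub t).const_mul a).exp
      simpa using this
    exact (h1.mul (hx s)).congr_deriv (by ring)
  have hc : Continuous fun s => Real.exp (a * (t - s)) * g s := by fun_prop
  have := intervalIntegral.sub_le_integral_of_hasDeriv_right_of_le ht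
    (fun s _ => (hd s).continuousAt.continuousWithinAt) (fun s _ => (hd s).hasDerivWithinAt)
    (hc.integrableOn_Icc) (fun s hs => ?_)
  · simpa [h0] using this
  · have := hle s hs.1.le
    gcongr
    linarith

/-- The variance of the empirical mean of `N` independent bounded random variables. -/
lemma integral_sq_mean_sub_le {Z : Type*} [MeasurableSpace Z] (ρ : Measure Z)
    [IsProbabilityMeasure ρ] {N : ℕ} (hN : 0 < N) {g : Z → ℝ} (hg : Measurable g)
    (hg1 : ∀ z, |g z| ≤ 1) :
    ∫ z, (1 / N * ∑ k : Fin N, g (z k) - ∫ w, g w ∂ρ) ^ 2 ∂(Measure.pi fun _ : Fin N => ρ) ≤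
      1 / N * ∫ w, g w ^ 2 ∂ρ := by
  have hN' : (0 : ℝ) < N := by exact_mod_cast hN
  have hLp : MemLp g 2 ρ := MemLp.of_bound hg.aestronglyMeasurable 1
    (Filter.Eventually.of_forall hg1)
  have hvar := ProbabilityTheory.variance_sum_pi (μ := fun _ : Fin N => ρ) (X := fun _ => g)
    fun _ => hLp
  have hint : ∀ k : Fin N, Integrable (fun z : Fin N → Z => g (z k))
      (Measure.pi fun _ : Fin N => ρ) := fun k =>
    Integrable.of_bound (hg.comp (measurable_pi_apply k)).aestronglyMeasurable 1
      (Filter.Eventually.of_forall fun z => hg1 _)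
  have hmean : ∫ z, (∑ k : Fin N, fun z : Fin N → Z => g (z k)) z ∂(Measure.pi fun _ : Fin N => ρ) =
      N * ∫ w, g w ∂ρ := by
    simp only [Finset.sum_apply]
    rw [integral_finsetSum _ fun k _ => hint k]
    have : ∀ k : Fin N, ∫ z : Fin N → Z, g (z k) ∂(Measure.pi fun _ : Fin N => ρ) =
        ∫ w, g w ∂ρ := fun k => by
      have h := integral_map (μ := Measure.pi fun _ : Fin N => ρ)
        (measurable_pi_apply k).aemeasurable (f := g) hg.aestronglyMeasurable
      rw [← h]
      exact congrArg (fun ν => ∫ w, g w ∂ν) (measurePreserving_eval (fun _ : Fin N => ρ) k).map_eq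
    simp [this]
  rw [ProbabilityTheory.variance_eq_integral
    (Finset.aemeasurable_sum _ fun k _ => (hint k).1.aemeasurable), hmean] at hvar
  have h2 : ∀ z : Fin N → Z, (1 / N * ∑ k : Fin N, g (z k) - ∫ w, g w ∂ρ) ^ 2 =
      (1 / N ^ 2 : ℝ) *
        ((∑ k : Fin N, fun z : Fin N → Z => g (z k)) z - N * ∫ w, g w ∂ρ) ^ 2 := by
    intro z
    simp only [Finset.sum_apply]
    field_simp
  simp only [h2]
  rw [integral_const_mul, hvar]
  simp only [Finset.sum_const, Finset.card_univ, Fintype.card_fin, nsmul_eq_mul]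
  have h3 := ProbabilityTheory.variance_le_expectation_sq (X := g) (μ := ρ)
    hg.aestronglyMeasurable
  calc 1 / (N : ℝ) ^ 2 * (N * ProbabilityTheory.variance g ρ)
      = 1 / N * ProbabilityTheory.variance g ρ := by field_simp
    _ ≤ _ := by gcongr; exact h3

/-- The law of large numbers in mean square: the empirical mean of `N` independent random unitary
matrices is at squared distance at most `d / N` from its expectation. -/
lemma integral_frobSq_mean_sub_le {Z : Type*} [MeasurableSpace Z] (ρ : Measure Z)
    [IsProbabilityMeasure ρ] {d N : ℕ} (hN : 0 < N) {W : Z → Matrix.unitaryGroup (Fin d) ℂ}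
    (hW : Measurable W) :
    ∫ z, frobSq (((1 / N : ℝ) : ℂ) • ∑ k : Fin N, ((W (z k) : Mat d)) -
      Matrix.of fun i j => ∫ w, (W w : Mat d) i j ∂ρ) ∂(Measure.pi fun _ : Fin N => ρ) ≤ d / N := by
  have hN' : (0 : ℝ) < N := by exact_mod_cast hN
  have hWm : ∀ i j, Measurable fun w => (W w : Mat d) i j := fun i j =>
    (measurable_pi_apply j).comp ((measurable_pi_apply i).comp (measurable_subtype_coe.comp hW))
  have hW1 : ∀ i j w, ‖(W w : Mat d) i j‖ ≤ 1 := fun i j w => entry_norm_bound_of_unitary (W w).2 i j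
  have hWi : ∀ i j, Integrable (fun w => (W w : Mat d) i j) ρ := fun i j =>
    Integrable.of_bound (hWm i j).aestronglyMeasurable 1 (Filter.Eventually.of_forall (hW1 i j))
  have hre : ∀ i j, Measurable fun w => ((W w : Mat d) i j).re := fun i j =>
    Complex.measurable_re.comp (hWm i j)
  have him : ∀ i j, Measurable fun w => ((W w : Mat d) i j).im := fun i j =>
    Complex.measurable_im.comp (hWm i j)
  have hre1 : ∀ i j w, |((W w : Mat d) i j).re| ≤ 1 := fun i j w =>
    (Complex.abs_re_le_norm _).trans (hW1 i j w)
  have him1 : ∀ i j w, |((W w : Mat d) i j).im| ≤ 1 := fun i j w =>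
    (Complex.abs_im_le_norm _).trans (hW1 i j w)
  have hsq : ∀ g : Z → ℝ, Measurable g → (∀ w, |g w| ≤ 1) → Integrable (fun w => g w ^ 2) ρ :=
    fun g h1 h2 => Integrable.of_bound (h1.pow_const 2).aestronglyMeasurable 1
      (Filter.Eventually.of_forall fun w => by
        rw [norm_pow, Real.norm_eq_abs]; exact pow_le_one₀ (abs_nonneg _) (h2 w))
  have hsqN : ∀ g : Z → ℝ, Measurable g → (∀ w, |g w| ≤ 1) → ∀ a : ℝ,
      Integrable (fun z : Fin N → Z => (1 / N * ∑ k : Fin N, g (z k) - a) ^ 2)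
        (Measure.pi fun _ : Fin N => ρ) := fun g h1 h2 a => by
    refine Integrable.of_bound (C := (1 + |a|) ^ 2) (Measurable.aestronglyMeasurable ?_)
      (Filter.Eventually.of_forall fun z => ?_)
    · have : ∀ k : Fin N, Measurable fun z : Fin N → Z => g (z k) := fun k =>
        h1.comp (measurable_pi_apply k)
      fun_prop
    · rw [norm_pow, Real.norm_eq_abs]
      gcongr
      refine (abs_sub _ _).trans (add_le_add_left ?_ _)
      rw [abs_mul, abs_of_pos (by positivity : (0 : ℝ) < 1 / N)]
      calc 1 / (N : ℝ) * |∑ k : Fin N, g (z k)| ≤ 1 / N * ∑ _k : Fin N, (1 : ℝ) := by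
            gcongr
            exact (Finset.abs_sum_le_sum_abs _ _).trans (Finset.sum_le_sum fun k _ => h2 _)
        _ = 1 := by simp; field_simp
  have hpt : ∀ z : Fin N → Z, frobSq (((1 / N : ℝ) : ℂ) • ∑ k : Fin N, ((W (z k) : Mat d)) -
      Matrix.of fun i j => ∫ w, (W w : Mat d) i j ∂ρ) =
      ∑ i, ∑ j, ((1 / N * ∑ k : Fin N, ((W (z k) : Mat d) i j).re -
        ∫ w, ((W w : Mat d) i j).re ∂ρ) ^ 2 + (1 / N * ∑ k : Fin N, ((W (z k) : Mat d) i j).im -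
        ∫ w, ((W w : Mat d) i j).im ∂ρ) ^ 2) := by
    intro z
    refine Finset.sum_congr rfl fun i _ => Finset.sum_congr rfl fun j _ => ?_
    have h1 : ∫ w, ((W w : Mat d) i j).re ∂ρ = (∫ w, (W w : Mat d) i j ∂ρ).re :=
      integral_re (hWi i j)
    have h2 : ∫ w, ((W w : Mat d) i j).im ∂ρ = (∫ w, (W w : Mat d) i j ∂ρ).im :=
      integral_im (hWi i j)
    rw [h1, h2, ← Complex.normSq_eq_norm_sq, Complex.normSq_apply]
    simp only [Matrix.sub_apply, Matrix.smul_apply, Matrix.sum_apply, Matrix.of_apply, smul_eq_mul,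
      Complex.sub_re, Complex.sub_im, Complex.re_ofReal_mul, Complex.im_ofReal_mul, Complex.re_sum,
      Complex.im_sum]
    ring
  simp only [hpt]
  have hI := fun i j => (hsqN _ (hre i j) (hre1 i j) (∫ w, ((W w : Mat d) i j).re ∂ρ))
  have hJ := fun i j => (hsqN _ (him i j) (him1 i j) (∫ w, ((W w : Mat d) i j).im ∂ρ))
  have hIJ : ∀ i j, Integrable (fun z : Fin N → Z => (1 / N * ∑ k : Fin N,
        ((W (z k) : Mat d) i j).re - ∫ w, ((W w : Mat d) i j).re ∂ρ) ^ 2 +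
        (1 / N * ∑ k : Fin N, ((W (z k) : Mat d) i j).im -
        ∫ w, ((W w : Mat d) i j).im ∂ρ) ^ 2) (Measure.pi fun _ : Fin N => ρ) :=
    fun i j => (hI i j).add (hJ i j)
  have hsq2 : ∀ i j, Integrable (fun w => ((W w : Mat d) i j).re ^ 2 +
      ((W w : Mat d) i j).im ^ 2) ρ := fun i j =>
    (hsq _ (hre i j) (hre1 i j)).add (hsq _ (him i j) (him1 i j))
  rw [integral_finsetSum _ fun i _ => integrable_finsetSum _ fun j _ => hIJ i j]
  have hrow : ∀ i, ∫ z : Fin N → Z, ∑ j, ((1 / N * ∑ k : Fin N, ((W (z k) : Mat d) i j).re -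
        ∫ w, ((W w : Mat d) i j).re ∂ρ) ^ 2 + (1 / N * ∑ k : Fin N, ((W (z k) : Mat d) i j).im -
        ∫ w, ((W w : Mat d) i j).im ∂ρ) ^ 2) ∂(Measure.pi fun _ : Fin N => ρ) ≤
      1 / N * ∫ w, ∑ j, ‖(W w : Mat d) i j‖ ^ 2 ∂ρ := by
    intro i
    have hn : ∀ w j, ‖(W w : Mat d) i j‖ ^ 2 =
        ((W w : Mat d) i j).re ^ 2 + ((W w : Mat d) i j).im ^ 2 := fun w j => by
      rw [← Complex.normSq_eq_norm_sq, Complex.normSq_apply]; ring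
    simp only [hn]
    rw [integral_finsetSum _ fun j _ => hIJ i j, integral_finsetSum _ fun j _ => hsq2 i j,
      Finset.mul_sum]
    refine Finset.sum_le_sum fun j _ => ?_
    rw [integral_add (hI i j) (hJ i j),
      integral_add (hsq _ (hre i j) (hre1 i j)) (hsq _ (him i j) (him1 i j)), mul_add]
    exact add_le_add (integral_sq_mean_sub_le ρ hN (hre i j) (hre1 i j))
      (integral_sq_mean_sub_le ρ hN (him i j) (him1 i j))
  refine (Finset.sum_le_sum fun i _ => hrow i).trans (le_of_eq ?_)
  have hint : ∀ i, Integrable (fun w => ∑ j, ‖(W w : Mat d) i j‖ ^ 2) ρ := fun i =>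
    integrable_finsetSum _ fun j _ => by
      simpa using hsq (fun w => ‖(W w : Mat d) i j‖) (hWm i j).norm
        (fun w => by rw [abs_norm]; exact hW1 i j w)
  rw [← Finset.mul_sum, ← integral_finsetSum _ fun i _ => hint i]
  have : ∀ w, ∑ i, ∑ j, ‖(W w : Mat d) i j‖ ^ 2 = (d : ℝ) := fun w => frobSq_unitary (W w)
  simp only [this]
  simp
  ring

/-! ### The coupling of the two dynamics -/

section

variable {d : ℕ}

lemma continuous_frobSq : Continuous (frobSq : Mat d → ℝ) :=
  continuous_finsetSum _ fun i _ => continuous_finsetSum _ fun j _ =>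
    ((continuous_apply_apply i j).norm).pow 2

lemma frobSq_sub_le {A B : Mat d} (hA : ∀ i j, ‖A i j‖ ≤ 1) (hB : ∀ i j, ‖B i j‖ ≤ 1) :
    frobSq (A - B) ≤ d * (d * 2 ^ 2) := by
  have h : ∀ i j, ‖(A - B) i j‖ ^ 2 ≤ 2 ^ 2 := fun i j => by
    gcongr
    exact (norm_sub_le _ _).trans (by linarith [hA i j, hB i j])
  calc frobSq (A - B) ≤ ∑ _i : Fin d, ∑ _j : Fin d, (2 : ℝ) ^ 2 :=
        Finset.sum_le_sum fun i _ => Finset.sum_le_sum fun j _ => h i j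
    _ = _ := by simp

lemma norm_mean_le_one {N : ℕ} (hN : 0 < N) {X : Fin N → Mat d} (hX : ∀ k i j, ‖X k i j‖ ≤ 1)
    (i j : Fin d) : ‖(((1 / N : ℝ) : ℂ) • ∑ k, X k) i j‖ ≤ 1 := by
  have hN' : (0 : ℝ) < N := by exact_mod_cast hN
  rw [Matrix.smul_apply, Matrix.sum_apply, smul_eq_mul, norm_mul, Complex.norm_real,
    Real.norm_of_nonneg (by positivity)]
  calc 1 / (N : ℝ) * ‖∑ k, X k i j‖ ≤ 1 / N * ∑ _k : Fin N, (1 : ℝ) := by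
        gcongr
        exact (norm_sum_le _ _).trans (Finset.sum_le_sum fun k _ => hX k i j)
    _ = 1 := by simp; field_simp

/-- The motion of one oscillator in a mean field, from a flow for a one-element family. -/
def single (Ψ : ℝ → (Unit → Phase d) → Unit → Phase d) (t : ℝ) (w : Phase d) : Phase d :=
  Ψ t (fun _ => w) ()

lemma IsTrajectory.hasDerivAt_fst {I : Type} [Fintype I] {α β : ℝ} {M : ℝ → Mat d}
    {u : ℝ → I → Phase d} (hu : IsTrajectory α β M u) (j : I) (t : ℝ) (i k : Fin d) :
    HasDerivAt (fun s => ((u s j).1 : Mat d) i k)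
      (((((u t j).2 : Mat d) + (drive α β (M t) (configToAmbient (u t)) * ((u t j).1 : Mat d)ᴴ -
        ((u t j).1 : Mat d) * (drive α β (M t) (configToAmbient (u t)))ᴴ)) *
          ((u t j).1 : Mat d)) i k) t :=
  (coord (j, false, false, i, k)).hasFDerivAt.comp_hasDerivAt t (hu t)

lemma conjTranspose_mul_self (U : Matrix.unitaryGroup (Fin d) ℂ) : (U : Mat d)ᴴ * U = 1 :=
  Matrix.mem_unitaryGroup_iff'.1 U.2

lemma measurable_entry (i j : Fin d) : Measurable fun w : Phase d => (w.1 : Mat d) i j :=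
  (measurable_pi_apply j).comp ((measurable_pi_apply i).comp
    (measurable_subtype_coe.comp measurable_fst))

lemma norm_entry_le (w : Phase d) (i j : Fin d) : ‖(w.1 : Mat d) i j‖ ≤ 1 :=
  entry_norm_bound_of_unitary w.1.2 i j

variable {N : ℕ} {κ : ℝ} {M : ℝ → Mat d} {Φ : ℝ → (Fin N → Phase d) → Fin N → Phase d}
  {Ψ : ℝ → (Unit → Phase d) → Unit → Phase d}

/-- The difference `U_j - V_j` of the interacting and the mean-field motion of oscillator `j`. -/
def deviation (Φ : ℝ → (Fin N → Phase d) → Fin N → Phase d)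
    (Ψ : ℝ → (Unit → Phase d) → Unit → Phase d) (t : ℝ) (z : Fin N → Phase d) (j : Fin N) : Mat d :=
  ((Φ t z j).1 : Mat d) - ((single Ψ t (z j)).1 : Mat d)

/-- The mean square deviation over the oscillators. -/
noncomputable def meanSqDeviation (Φ : ℝ → (Fin N → Phase d) → Fin N → Phase d)
    (Ψ : ℝ → (Unit → Phase d) → Unit → Phase d) (t : ℝ) (z : Fin N → Phase d) : ℝ :=
  1 / N * ∑ j, frobSq (deviation Φ Ψ t z j)

/-- The empirical mean of the mean-field motions. -/
noncomputable def empiricalMean (Ψ : ℝ → (Unit → Phase d) → Unit → Phase d) (t : ℝ)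
    (z : Fin N → Phase d) : Mat d :=
  ((1 / N : ℝ) : ℂ) • ∑ k, ((single Ψ t (z k)).1 : Mat d)

/-- The dissipation inequality for the mean square deviation of the two motions started from
the same configuration. -/
lemma exists_deriv_meanSqDeviation_le (hN : 0 < N) (hκ : 0 ≤ κ)
    (hΦ : IsFlow 0 (κ / (2 * N)) M Φ) (hΨ : IsFlow (κ / 2) 0 M Ψ) (z : Fin N → Phase d) :
    ∃ x' : ℝ → ℝ, ∀ s, HasDerivAt (fun s => meanSqDeviation Φ Ψ s z) (x' s) s ∧
      x' s ≤ 9 / 2 * κ * meanSqDeviation Φ Ψ s z +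
        2 * κ * frobSq (empiricalMean Ψ s z - M s) := by
  have hN' : (0 : ℝ) < N := by exact_mod_cast hN
  set Ub : ℝ → Mat d := fun s => ((1 / N : ℝ) : ℂ) • ∑ k, ((Φ s z k).1 : Mat d)
  set Vb : ℝ → Mat d := fun s => empiricalMean Ψ s z
  have hP : ∀ s, drive 0 (κ / (2 * N)) (M s) (configToAmbient (Φ s z)) =
      ((κ / 2 : ℝ) : ℂ) • Ub s := by
    intro s
    have : drive 0 (κ / (2 * N)) (M s) (configToAmbient (Φ s z)) =
        ((κ / (2 * N) : ℝ) : ℂ) • ∑ k, ((Φ s z k).1 : Mat d) := by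
      rw [drive, Complex.ofReal_zero, zero_smul, zero_add]; rfl
    rw [this, smul_smul, ← Complex.ofReal_mul]
    congr 3
    field_simp
  have hQ : ∀ s (w : Phase d), drive (κ / 2) 0 (M s) (configToAmbient (Ψ s fun _ => w)) =
      ((κ / 2 : ℝ) : ℂ) • M s := by
    intro s w
    rw [drive, Complex.ofReal_zero, zero_smul, add_zero]
  set R : ℝ → Fin N → ℝ := fun s j => frobInner (deviation Φ Ψ s z j *
      ((single Ψ s (z j)).1 : Mat d)ᴴ)
    ((Ub s * ((Φ s z j).1 : Mat d)ᴴ - ((Φ s z j).1 : Mat d) * (Ub s)ᴴ) -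
      (M s * ((single Ψ s (z j)).1 : Mat d)ᴴ - ((single Ψ s (z j)).1 : Mat d) * (M s)ᴴ))
  have hd : ∀ s j, HasDerivAt (fun s => frobSq (deviation Φ Ψ s z j)) (κ * R s j) s := by
    intro s j
    have h1 := (hΦ.isTrajectory z).hasDerivAt_fst j
    have h2 := (hΨ.isTrajectory fun _ => z j).hasDerivAt_fst ()
    simp only [hP] at h1
    simp only [hQ] at h2
    refine (hasDerivAt_frobSq (D := fun s => deviation Φ Ψ s z j)
      (D' := fun t => ((((Φ t z j).2 : Mat d) + ((((κ / 2 : ℝ) : ℂ) • Ub t) *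
          ((Φ t z j).1 : Mat d)ᴴ - ((Φ t z j).1 : Mat d) * (((κ / 2 : ℝ) : ℂ) • Ub t)ᴴ)) *
          ((Φ t z j).1 : Mat d)) -
        ((((Φ t z j).2 : Mat d) + ((((κ / 2 : ℝ) : ℂ) • M t) *
          ((single Ψ t (z j)).1 : Mat d)ᴴ -
          ((single Ψ t (z j)).1 : Mat d) * (((κ / 2 : ℝ) : ℂ) • M t)ᴴ)) *
          ((single Ψ t (z j)).1 : Mat d))) fun i k => ?_).congr_deriv ?_
    · have hA : (Φ s z j).2 = (Ψ s (fun _ => z j) ()).2 := by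
        have e1 := (hΦ.isTrajectory z).snd_eq s j
        have e2 := (hΨ.isTrajectory fun _ => z j).snd_eq s ()
        simp only [hΦ.zero] at e1
        simp only [hΨ.zero] at e2
        rw [e1, e2]
      have h3 := (h1 s i k).sub (h2 s i k)
      rw [← hA] at h3
      exact h3
    · have hsk : ((Φ s z j).2 : Mat d)ᴴ = -((Φ s z j).2 : Mat d) := (Φ s z j).2.2
      have h4 := frobInner_velocity_sub (U := ((Φ s z j).1 : Mat d))
        (V := ((single Ψ s (z j)).1 : Mat d)) hsk (((κ / 2 : ℝ) : ℂ) • Ub s)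
        (((κ / 2 : ℝ) : ℂ) • M s)
      simp only [deviation]
      rw [h4]
      simp only [Matrix.conjTranspose_smul, Complex.star_def, Complex.conj_ofReal,
        Matrix.smul_mul, Matrix.mul_smul, ← smul_sub, frobInner_smul_right, R, deviation]
      ring
  -- an average of unitary matrices is a contraction
  have hVb : ∀ s (X : Mat d), frobSq (Vb s * X) ≤ frobSq X := by
    intro s X
    have h1 : Vb s * X = ((1 / N : ℝ) : ℂ) • ∑ k, ((single Ψ s (z k)).1 : Mat d) * X := by
      simp only [Vb, empiricalMean, Matrix.smul_mul, Finset.sum_mul]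
    rw [h1]
    refine (frobSq_mean_le hN _).trans (le_of_eq ?_)
    simp only [frobSq_unitary_mul (conjTranspose_mul_self _)]
    simp
    field_simp
  refine ⟨fun s => 1 / N * ∑ j, κ * R s j, fun s =>
    ⟨(HasDerivAt.fun_sum fun j _ => hd s j).const_mul _, ?_⟩⟩
  have hR : ∀ j, R s j ≤ 7 / 2 * frobSq (deviation Φ Ψ s z j) + frobSq (Ub s - Vb s) +
      2 * frobSq (Vb s - M s) := fun j =>
    frobInner_coupling_le (conjTranspose_mul_self _) (conjTranspose_mul_self _) (hVb s)
  have hUV : frobSq (Ub s - Vb s) ≤ meanSqDeviation Φ Ψ s z := by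
    have h1 : Ub s - Vb s = ((1 / N : ℝ) : ℂ) • ∑ k, deviation Φ Ψ s z k := by
      simp only [Ub, Vb, empiricalMean, deviation, Finset.sum_sub_distrib, smul_sub]
    rw [h1]
    exact frobSq_mean_le hN _
  calc 1 / (N : ℝ) * ∑ j, κ * R s j
      ≤ 1 / N * ∑ j, κ * (7 / 2 * frobSq (deviation Φ Ψ s z j) + meanSqDeviation Φ Ψ s z +
        2 * frobSq (Vb s - M s)) := by
        gcongr with j
        exact (hR j).trans (by gcongr)
    _ = 7 / 2 * κ * (1 / N * ∑ j, frobSq (deviation Φ Ψ s z j)) +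
        κ * (meanSqDeviation Φ Ψ s z + 2 * frobSq (Vb s - M s)) := by
        simp only [← Finset.mul_sum, Finset.sum_add_distrib, Finset.sum_const, Finset.card_univ,
          Fintype.card_fin, nsmul_eq_mul]
        field_simp
        ring
    _ = _ := by
        rw [show 1 / (N : ℝ) * ∑ j, frobSq (deviation Φ Ψ s z j) = meanSqDeviation Φ Ψ s z from rfl]
        ring

lemma continuous_single_time (hΨ : IsFlow (κ / 2) 0 M Ψ) (w : Phase d) :
    Continuous fun t => single Ψ t w :=
  (continuous_apply ()).comp (hΨ.continuous_time _)

lemma continuous_single (hΨ : IsFlow (κ / 2) 0 M Ψ) {t : ℝ} (ht : 0 ≤ t) :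
    Continuous (single Ψ t) :=
  (continuous_apply ()).comp ((hΨ.continuous t ht).comp (continuous_pi fun _ => continuous_id))

lemma continuous_val_fst : Continuous fun w : Phase d => (w.1 : Mat d) :=
  continuous_subtype_val.comp continuous_fst

/-- The expected mean square deviation, for independent identically distributed initial data
whose mean-field motions have the expectation `M`. -/
lemma integral_meanSqDeviation_le (hN : 0 < N) (hκ : 0 ≤ κ) (hM : Continuous M)
    (hM1 : ∀ s i k, ‖M s i k‖ ≤ 1) (hΦ : IsFlow 0 (κ / (2 * N)) M Φ)
    (hΨ : IsFlow (κ / 2) 0 M Ψ) (ρ : Measure (Phase d)) [IsProbabilityMeasure ρ]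
    (hmean : ∀ s, 0 ≤ s → M s = Matrix.of fun i j => ∫ w, ((single Ψ s w).1 : Mat d) i j ∂ρ)
    {a : ℝ} (ha : 9 / 2 * κ ≤ a) (ha0 : 0 < a) {t : ℝ} (ht : 0 ≤ t) :
    ∫ z, meanSqDeviation Φ Ψ t z ∂(Measure.pi fun _ : Fin N => ρ) ≤
      2 * κ * d / (N * a) * (Real.exp (a * t) - 1) := by
  have hN' : (0 : ℝ) < N := by exact_mod_cast hN
  set π : Measure (Fin N → Phase d) := Measure.pi fun _ : Fin N => ρ
  set e : ℝ → (Fin N → Phase d) → ℝ := fun s z => frobSq (empiricalMean Ψ s z - M s)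
  have het : ∀ z, Continuous fun s => e s z := fun z => by
    have h1 : Continuous fun s => ∑ k, ((single Ψ s (z k)).1 : Mat d) :=
      continuous_finsetSum _ fun k _ => continuous_val_fst.comp (continuous_single_time hΨ (z k))
    exact continuous_frobSq.comp (((h1.const_smul ((1 / N : ℝ) : ℂ)).sub hM).congr fun s => rfl)
  have hez : ∀ s, 0 ≤ s → Continuous (e s) := fun s hs => by
    have h1 : Continuous fun z : Fin N → Phase d => ∑ k, ((single Ψ s (z k)).1 : Mat d) :=
      continuous_finsetSum _ fun k _ =>
        continuous_val_fst.comp ((continuous_single hΨ hs).comp (continuous_apply k))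
    exact continuous_frobSq.comp
      (((h1.const_smul ((1 / N : ℝ) : ℂ)).sub continuous_const).congr fun z => rfl)
  have heb : ∀ s z, ‖e s z‖ ≤ d * (d * 2 ^ 2) := fun s z => by
    rw [Real.norm_of_nonneg (frobSq_nonneg _)]
    exact frobSq_sub_le (norm_mean_le_one hN fun k i j => norm_entry_le _ i j) (hM1 s)
  have hx0 : ∀ z, meanSqDeviation Φ Ψ 0 z = 0 := fun z => by
    simp [meanSqDeviation, deviation, single, hΦ.zero, hΨ.zero, frobSq]
  have hxn : ∀ s z, 0 ≤ meanSqDeviation Φ Ψ s z := fun s z =>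
    mul_nonneg (by positivity) (Finset.sum_nonneg fun j _ => frobSq_nonneg _)
  have hpath : ∀ z, meanSqDeviation Φ Ψ t z ≤
      ∫ s in (0 : ℝ)..t, Real.exp (a * (t - s)) * (2 * κ * e s z) := by
    intro z
    obtain ⟨x', hx'⟩ := exists_deriv_meanSqDeviation_le hN hκ hΦ hΨ z
    refine le_integral_of_deriv_le (fun s => (hx' s).1) (continuous_const.mul (het z)) (hx0 z) ht
      fun s _ => (hx' s).2.trans ?_
    exact add_le_add_left (mul_le_mul_of_nonneg_right ha (hxn s z)) _
  -- the flow is only known to be continuous at times `s ≥ 0`; `max s 0` makes `h` measurable on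
  -- the whole product
  set h : ℝ → (Fin N → Phase d) → ℝ := fun s z =>
    Real.exp (a * (t - max s 0)) * (2 * κ * e (max s 0) z)
  have hh : ∀ z, ∫ s in (0 : ℝ)..t, Real.exp (a * (t - s)) * (2 * κ * e s z) =
      ∫ s in (0 : ℝ)..t, h s z := fun z =>
    intervalIntegral.integral_congr fun s hs => by
      rw [Set.uIcc_of_le ht] at hs; simp only [h, max_eq_left hs.1]
  have hmeas : StronglyMeasurable (Function.uncurry h) := by
    refine stronglyMeasurable_uncurry_of_continuous_of_stronglyMeasurable (fun z => ?_)
      (fun s => ?_)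
    · have := (het z).comp (continuous_id.max continuous_const : Continuous fun s : ℝ => max s 0)
      simp only [Function.comp_def, id] at this
      fun_prop
    · exact (continuous_const.mul (continuous_const.mul
        (hez _ (le_max_right s 0)))).stronglyMeasurable
  have hbd : ∀ p : ℝ × (Fin N → Phase d), ‖Function.uncurry h p‖ ≤
      Real.exp (a * t) * (2 * κ * (d * (d * 2 ^ 2))) := fun p => by
    simp only [Function.uncurry, h]
    rw [norm_mul, norm_mul, Real.norm_of_nonneg (Real.exp_nonneg _),
      Real.norm_of_nonneg (by positivity : 0 ≤ 2 * κ)]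
    gcongr
    · linarith [le_max_right p.1 0]
    · exact heb _ _
  have hI : Integrable (Function.uncurry h) ((volume.restrict (Set.Ioc 0 t)).prod π) :=
    Integrable.of_bound hmeas.aestronglyMeasurable _ (Filter.Eventually.of_forall hbd)
  have hswap : ∫ z, (∫ s in (0 : ℝ)..t, h s z) ∂π = ∫ s in (0 : ℝ)..t, ∫ z, h s z ∂π := by
    simp only [intervalIntegral.integral_of_le ht]
    exact (integral_integral_swap hI).symm
  have hxi : Integrable (fun z => ∫ s in (0 : ℝ)..t, h s z) π := by
    simp only [intervalIntegral.integral_of_le ht]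
    exact hI.integral_prod_right
  have hEe : ∀ s, 0 ≤ s → ∫ z, e s z ∂π ≤ d / N := by
    intro s hs
    have := integral_frobSq_mean_sub_le ρ hN (W := fun w => (single Ψ s w).1)
      (measurable_fst.comp (continuous_single hΨ hs).measurable)
    rw [← hmean s hs] at this
    exact this
  have hEh : ∀ s ∈ Set.Icc 0 t, ∫ z, h s z ∂π ≤ Real.exp (a * (t - s)) * (2 * κ * (d / N)) := by
    intro s hs
    simp only [h, max_eq_left hs.1]
    rw [integral_const_mul, integral_const_mul]
    gcongr
    exact hEe s hs.1
  have hHi : IntervalIntegrable (fun s => ∫ z, h s z ∂π) volume 0 t := by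
    rw [intervalIntegrable_iff_integrableOn_Ioc_of_le ht]
    exact hI.integral_prod_left
  have hci : Continuous fun s => Real.exp (a * (t - s)) * (2 * κ * (d / N)) := by fun_prop
  have hexp : ∫ s in (0 : ℝ)..t, Real.exp (a * (t - s)) = (Real.exp (a * t) - 1) / a := by
    have hd : ∀ s ∈ Set.uIcc 0 t, HasDerivAt (fun s => -(Real.exp (a * (t - s)) / a))
        (Real.exp (a * (t - s))) s := fun s _ => by
      have := ((((hasDerivAt_id s).const_sub t).const_mul a).exp.div_const a).neg
      refine this.congr_deriv ?_
      simp only [id]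
      field_simp
    rw [intervalIntegral.integral_eq_sub_of_hasDerivAt hd
      ((by fun_prop : Continuous fun s => Real.exp (a * (t - s))).intervalIntegrable _ _)]
    simp
    ring
  calc ∫ z, meanSqDeviation Φ Ψ t z ∂π ≤ ∫ z, (∫ s in (0 : ℝ)..t, h s z) ∂π :=
        integral_mono_of_nonneg (Filter.Eventually.of_forall fun z => hxn t z) hxi
          (Filter.Eventually.of_forall fun z => (hpath z).trans_eq (hh z))
    _ = ∫ s in (0 : ℝ)..t, ∫ z, h s z ∂π := hswap
    _ ≤ ∫ s in (0 : ℝ)..t, Real.exp (a * (t - s)) * (2 * κ * (d / N)) :=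
        intervalIntegral.integral_mono_on ht hHi (hci.intervalIntegrable _ _) hEh
    _ = _ := by
        rw [intervalIntegral.integral_mul_const, hexp]
        field_simp

end

/-! ### Exchangeability -/

section

variable {d N : ℕ} {κ : ℝ} {M : ℝ → Mat d}

lemma drivenField_comp_perm {I : Type} [Fintype I] (α β : ℝ) (m : Mat d) (σ : Equiv.Perm I)
    (e : I → Ambient d) : drivenField α β m (e ∘ σ) = drivenField α β m e ∘ σ := by
  have h : drive α β m (e ∘ σ) = drive α β m e := by
    simp only [drive, Function.comp_apply, Equiv.sum_comp σ fun k => Matrix.of (e k).1]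
  funext j
  simp only [drivenField, h, Function.comp_apply]

/-- The flow commutes with permutations of the oscillators. -/
lemma IsFlow.comp_perm {I : Type} [Fintype I] {α β : ℝ} {Φ : ℝ → (I → Phase d) → I → Phase d}
    (h : IsFlow α β M Φ) (σ : Equiv.Perm I) (z : I → Phase d) {t : ℝ} (ht : 0 ≤ t) :
    Φ t (z ∘ σ) = Φ t z ∘ σ := by
  have hu : IsTrajectory α β M fun s => Φ s z ∘ σ := by
    intro s
    have h1 : ∀ w : I → Phase d, configToAmbient (w ∘ σ) = configToAmbient w ∘ σ := fun _ => rfl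
    simp only [h1, drivenField_comp_perm]
    exact hasDerivAt_pi.2 fun j => hasDerivAt_pi.1 (h.isTrajectory z s) (σ j)
  have := h.eq_of_isTrajectory _ hu t ht
  simp only [h.zero] at this
  exact this.symm

lemma measurePreserving_comp_perm {Z : Type*} [MeasurableSpace Z] (ρ : Measure Z)
    [IsProbabilityMeasure ρ] {I : Type*} [Fintype I] (σ : Equiv.Perm I) :
    MeasurePreserving (fun z : I → Z => z ∘ σ) (Measure.pi fun _ : I => ρ)
      (Measure.pi fun _ : I => ρ) := by
  have h := measurePreserving_piCongrLeft (α := fun _ : I => Z) (fun _ : I => ρ) σ.symm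
  have he : (MeasurableEquiv.piCongrLeft (fun _ : I => Z) σ.symm : (I → Z) → I → Z) =
      fun z => z ∘ σ := by
    funext z j
    have := Equiv.piCongrLeft_apply_apply (fun _ : I => Z) σ.symm z (σ j)
    rw [Equiv.symm_apply_apply] at this
    exact this
  rwa [he] at h

variable {Φ : ℝ → (Fin N → Phase d) → Fin N → Phase d}
  {Ψ : ℝ → (Unit → Phase d) → Unit → Phase d}

lemma continuous_frobSq_deviation (hΦ : IsFlow 0 (κ / (2 * N)) M Φ) (hΨ : IsFlow (κ / 2) 0 M Ψ)
    {t : ℝ} (ht : 0 ≤ t) (j : Fin N) : Continuous fun z => frobSq (deviation Φ Ψ t z j) := by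
  have h1 : Continuous fun z => ((Φ t z j).1 : Mat d) :=
    continuous_val_fst.comp ((continuous_apply j).comp (hΦ.continuous t ht))
  have h2 : Continuous fun z : Fin N → Phase d => ((single Ψ t (z j)).1 : Mat d) :=
    continuous_val_fst.comp ((continuous_single hΨ ht).comp (continuous_apply j))
  exact continuous_frobSq.comp (h1.sub h2)

lemma integrable_frobSq_deviation (hΦ : IsFlow 0 (κ / (2 * N)) M Φ)
    (hΨ : IsFlow (κ / 2) 0 M Ψ) (π : Measure (Fin N → Phase d)) [IsProbabilityMeasure π]
    {t : ℝ} (ht : 0 ≤ t) (j : Fin N) : Integrable (fun z => frobSq (deviation Φ Ψ t z j)) π :=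
  Integrable.of_bound (continuous_frobSq_deviation hΦ hΨ ht j).aestronglyMeasurable
    (d * (d * 2 ^ 2)) (Filter.Eventually.of_forall fun z => by
      rw [Real.norm_of_nonneg (frobSq_nonneg _)]
      exact frobSq_sub_le (norm_entry_le _) (norm_entry_le _))

/-- By exchangeability the first oscillator has the same mean square deviation as the average
over all oscillators. -/
lemma integral_frobSq_deviation_eq (hN : 0 < N) (hΦ : IsFlow 0 (κ / (2 * N)) M Φ)
    (hΨ : IsFlow (κ / 2) 0 M Ψ) (ρ : Measure (Phase d)) [IsProbabilityMeasure ρ]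
    {t : ℝ} (ht : 0 ≤ t) (j₀ : Fin N) :
    ∫ z, frobSq (deviation Φ Ψ t z j₀) ∂(Measure.pi fun _ : Fin N => ρ) =
      ∫ z, meanSqDeviation Φ Ψ t z ∂(Measure.pi fun _ : Fin N => ρ) := by
  have hN' : (N : ℝ) ≠ 0 := by exact_mod_cast hN.ne'
  have hj : ∀ j, ∫ z, frobSq (deviation Φ Ψ t z j) ∂(Measure.pi fun _ : Fin N => ρ) =
      ∫ z, frobSq (deviation Φ Ψ t z j₀) ∂(Measure.pi fun _ : Fin N => ρ) := by
    intro j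
    have hmp := measurePreserving_comp_perm ρ (Equiv.swap j₀ j)
    have h1 := integral_map (μ := Measure.pi fun _ : Fin N => ρ) hmp.measurable.aemeasurable
      (f := fun z => frobSq (deviation Φ Ψ t z j₀))
      (continuous_frobSq_deviation hΦ hΨ ht j₀).aestronglyMeasurable
    rw [hmp.map_eq] at h1
    rw [h1]
    refine integral_congr_ae (Filter.Eventually.of_forall fun z => ?_)
    simp only [deviation, hΦ.comp_perm _ z ht, Function.comp_apply, Equiv.swap_apply_left]
  simp only [meanSqDeviation]
  rw [integral_const_mul,
    integral_finsetSum _ fun j _ => integrable_frobSq_deviation hΦ hΨ _ ht j]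
  simp only [hj, Finset.sum_const, Finset.card_univ, Fintype.card_fin, nsmul_eq_mul]
  field_simp

end

/-! ### The kinetic equation as a driven system -/

/-- Transport of a weak solution along a continuous map which is compatible with a linear
isomorphism of the ambient spaces. -/
lemma IsWeakSolution.map {X Y E F : Type} [TopologicalSpace X] [MeasurableSpace X] [BorelSpace X]
    [TopologicalSpace Y] [MeasurableSpace Y] [BorelSpace Y]
    [NormedAddCommGroup E] [NormedSpace ℝ E] [NormedAddCommGroup F] [NormedSpace ℝ F]
    {ι : X → E} {ι' : Y → F} {b : ℝ → X → E} {b' : ℝ → Y → F} {μ₀ : ProbabilityMeasure X}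
    {μ : ℝ → ProbabilityMeasure X} (h : IsWeakSolution ι b μ₀ μ) {g : X → Y} (hg : Continuous g)
    (L : E ≃L[ℝ] F) (hι : ∀ x, ι' (g x) = L (ι x)) (hb : ∀ s x, b' s (g x) = L (b s x))
    (hι' : Continuous ι') (hb' : ∀ s, 0 ≤ s → Continuous (b' s)) :
    IsWeakSolution ι' b' (μ₀.map hg.measurable.aemeasurable)
      (fun t => (μ t).map hg.measurable.aemeasurable) where
  continuousOn := (ProbabilityMeasure.continuous_map hg).comp_continuousOn h.continuousOn
  initial := by rw [h.initial]
  weak φ h1 h2 t ht := by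
    have hL : ContDiff ℝ 1 fun e => φ (L e) := h1.comp L.contDiff
    have hc : HasCompactSupport fun e => φ (L e) := h2.comp_homeomorph L.toHomeomorph
    have hw := h.weak _ hL hc t ht
    have hφ : Continuous fun y => φ (ι' y) := h1.continuous.comp hι'
    have hm : ∀ (ν : ProbabilityMeasure X), ∫ y, φ (ι' y)
        ∂((ν.map hg.measurable.aemeasurable : ProbabilityMeasure Y) : Measure Y) =
        ∫ x, φ (L (ι x)) ∂(ν : Measure X) := by
      intro ν
      rw [ProbabilityMeasure.toMeasure_map, integral_map hg.measurable.aemeasurable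
        hφ.aestronglyMeasurable]
      simp only [hι]
    rw [hm, hm, hw]
    congr 1
    refine intervalIntegral.integral_congr fun s hs => ?_
    rw [Set.uIcc_of_le ht] at hs
    have hcont : Continuous fun y => fderiv ℝ φ (ι' y) (b' s y) :=
      ((h1.continuous_fderiv (by simp)).comp hι').clm_apply (hb' s hs.1)
    simp only [ProbabilityMeasure.toMeasure_map]
    rw [integral_map hg.measurable.aemeasurable hcont.aestronglyMeasurable]
    refine integral_congr_ae (Filter.Eventually.of_forall fun x => ?_)
    have hd : HasFDerivAt (fun e => φ (L e)) ((fderiv ℝ φ (L (ι x))).comp (L : E →L[ℝ] F)) (ι x) :=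
      ((h1.differentiable (by simp)) _).hasFDerivAt.comp _ L.hasFDerivAt
    simp only [hι, hb, hd.fderiv]
    rfl

section

variable {d : ℕ}

/-- The expectation of the unitary component, entry by entry. -/
noncomputable def meanU (m : ProbabilityMeasure (Phase d)) : Mat d :=
  Matrix.of fun i j => ∫ w, (w.1 : Mat d) i j ∂(m : Measure (Phase d))

lemma integrable_entry (m : ProbabilityMeasure (Phase d)) (i j : Fin d) :
    Integrable (fun w : Phase d => (w.1 : Mat d) i j) (m : Measure (Phase d)) :=
  Integrable.of_bound (measurable_entry i j).aestronglyMeasurable 1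
    (Filter.Eventually.of_forall fun w => norm_entry_le w i j)

lemma norm_meanU_le (m : ProbabilityMeasure (Phase d)) (i j : Fin d) : ‖meanU m i j‖ ≤ 1 := by
  simpa [meanU] using norm_integral_le_of_norm_le_const (μ := (m : Measure (Phase d)))
    (Filter.Eventually.of_forall fun w => norm_entry_le w i j)

lemma meanK_eq (m : ProbabilityMeasure (Phase d)) (U : Mat d) :
    meanK m U = meanU m * Uᴴ - U * (meanU m)ᴴ := by
  ext i j
  have h1 : Continuous fun V : Matrix.unitaryGroup (Fin d) ℂ => K (V : Mat d) U i j := by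
    have hV : Continuous fun V : Matrix.unitaryGroup (Fin d) ℂ => (V : Mat d) :=
      continuous_subtype_val
    have : Continuous fun V : Matrix.unitaryGroup (Fin d) ℂ => K (V : Mat d) U :=
      (hV.matrix_mul continuous_const).sub (continuous_const.matrix_mul hV.matrix_conjTranspose)
    exact this.matrix_elem i j
  rw [meanK, Matrix.of_apply, integral_map measurable_fst.aemeasurable h1.aestronglyMeasurable]
  simp only [K, Matrix.sub_apply, Matrix.mul_apply, Matrix.conjTranspose_apply, meanU,
    Matrix.of_apply, Complex.star_def]
  have hc : ∀ l, Integrable (fun w : Phase d => (starRingEnd ℂ) ((w.1 : Mat d) j l))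
      (m : Measure (Phase d)) := fun l =>
    (Complex.conjCLE : ℂ →L[ℝ] ℂ).integrable_comp (integrable_entry m j l)
  rw [integral_sub (integrable_finsetSum _ fun l _ => (integrable_entry m i l).mul_const _)
    (integrable_finsetSum _ fun l _ => (hc l).const_mul _),
    integral_finsetSum _ fun l _ => (integrable_entry m i l).mul_const _,
    integral_finsetSum _ fun l _ => (hc l).const_mul _]
  simp only [integral_mul_const, integral_const_mul, integral_conj]

lemma kineticField_eq (κ : ℝ) (m : ProbabilityMeasure (Phase d)) (z : Unit → Phase d) :
    drivenField (κ / 2) 0 (meanU m) (configToAmbient z) = fun _ => kineticField κ m (z ()) := by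
  funext j
  have hP : drive (κ / 2) 0 (meanU m) (configToAmbient z) = ((κ / 2 : ℝ) : ℂ) • meanU m := by
    rw [drive, Complex.ofReal_zero, zero_smul, add_zero]
  rw [drivenField, kineticField, meanK_eq, hP, Matrix.conjTranspose_smul, Complex.star_def,
    Complex.conj_ofReal, Matrix.smul_mul, Matrix.mul_smul, ← smul_sub]
  rfl

lemma loheField_eq {N : ℕ} (κ : ℝ) (m : Mat d) (z : Fin N → Phase d) :
    drivenField 0 (κ / (2 * N)) m (configToAmbient z) = loheField κ z := by
  funext j
  have hP : drive 0 (κ / (2 * N)) m (configToAmbient z) =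
      ((κ / (2 * N) : ℝ) : ℂ) • ∑ k, ((z k).1 : Mat d) := by
    rw [drive, Complex.ofReal_zero, zero_smul, zero_add]; rfl
  have hK : ∑ k, K ((z k).1 : Mat d) ((z j).1 : Mat d) =
      (∑ k, ((z k).1 : Mat d)) * ((z j).1 : Mat d)ᴴ -
        ((z j).1 : Mat d) * (∑ k, ((z k).1 : Mat d))ᴴ := by
    simp only [K, Finset.sum_sub_distrib, Finset.sum_mul, Finset.mul_sum, Matrix.conjTranspose_sum]
  rw [drivenField, loheField, hK, hP, Matrix.conjTranspose_smul, Complex.star_def,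
    Complex.conj_ofReal, Matrix.smul_mul, Matrix.mul_smul, ← smul_sub]
  rfl

lemma continuous_meanU {f : ℝ → ProbabilityMeasure (Phase d)} (hf : ContinuousOn f (Set.Ici 0)) :
    Continuous fun s => meanU (f (max s 0)) := by
  refine continuous_matrix fun i j => ?_
  have hc : Continuous fun w : Phase d => (w.1 : Mat d) i j := continuous_val_fst.matrix_elem i j
  exact (continuousOn_integral_of_bounded hf hc (norm_entry_le · i j)).comp_continuous
    (continuous_id.max continuous_const) fun s => le_max_right s 0

/-- The kinetic Lohe solution is transported by the flow of one oscillator in the mean field. Once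
`f` is given, the kinetic equation is a linear continuity equation, to which uniqueness applies.
The mean field is extended to negative times by its value at time `0`. -/
lemma IsKineticLoheSolution.map_single {κ : ℝ} {f₀ : ProbabilityMeasure (Phase d)}
    {f : ℝ → ProbabilityMeasure (Phase d)} (hf : IsKineticLoheSolution κ f₀ f)
    {Ψ : ℝ → (Unit → Phase d) → Unit → Phase d}
    (hΨ : IsFlow (κ / 2) 0 (fun s => meanU (f (max s 0))) Ψ) {t : ℝ} (ht : 0 ≤ t) :
    (f t : Measure (Phase d)) = (f₀ : Measure (Phase d)).map (single Ψ t) := by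
  set M : ℝ → Mat d := fun s => meanU (f (max s 0))
  have hM : Continuous M := continuous_meanU hf.continuousOn
  have hM1 : ∀ s i k, ‖M s i k‖ ≤ 1 := fun s i k => norm_meanU_le _ i k
  have hg : Continuous fun (w : Phase d) (_ : Unit) => w := continuous_pi fun _ => continuous_id
  have hb : ∀ s, Continuous fun z : Unit → Phase d =>
      drivenField (κ / 2) 0 (M s) (configToAmbient z) := fun s => by
    have h1 : Continuous fun z : Unit → Phase d =>
        (((M s : Fin d → Fin d → ℂ), configToAmbient z) :
          (Fin d → Fin d → ℂ) × (Unit → Ambient d)) :=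
      continuous_const.prodMk continuous_configToAmbient
    exact ((contDiff_drivenField (κ / 2) 0).continuous.comp h1).congr fun z => rfl
  have hf' : IsWeakSolution toAmbient (fun s => kineticField κ (f (max s 0))) f₀ f :=
    IsWeakSolution.congr hf fun s x hs => by simp only [max_eq_left hs]
  have hw := hf'.map hg (ContinuousLinearEquiv.funUnique Unit ℝ (Ambient d)).symm
    (ι' := configToAmbient) (b' := fun s z => drivenField (κ / 2) 0 (M s) (configToAmbient z))
    (fun x => rfl) (fun s x => kineticField_eq κ _ _) continuous_configToAmbient fun s _ => hb s
  have h2 := hΨ.map_eq_of_isWeakSolution hM hM1 hw ht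
  simp only [ProbabilityMeasure.toMeasure_map] at h2
  have he : Measurable fun z : Unit → Phase d => z () := measurable_pi_apply ()
  have h3 := congrArg (Measure.map fun z : Unit → Phase d => z ()) h2
  rw [Measure.map_map he hg.measurable, Measure.map_map he (hΨ.continuous t ht).measurable,
    Measure.map_map (he.comp (hΨ.continuous t ht).measurable) hg.measurable] at h3
  have h4 : single Ψ t = fun w => Ψ t (fun _ => w) () := rfl
  rw [h4]
  simpa [Function.comp_def] using h3

/-- The estimate with a free growth rate `a`, from the coupling of the two motions. -/
theorem distMK2_sq_le {N : ℕ} (hN : 0 < N) {κ : ℝ} (hκ : 0 ≤ κ)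
    {f₀ : ProbabilityMeasure (Phase d)} {f : ℝ → ProbabilityMeasure (Phase d)}
    (hf : IsKineticLoheSolution κ f₀ f) {F : ℝ → ProbabilityMeasure (Fin N → Phase d)}
    (hF : IsLiouvilleSolution κ (ProbabilityMeasure.pi fun _ : Fin N => f₀) F)
    {a : ℝ} (ha : 9 / 2 * κ ≤ a) (ha0 : 0 < a) {t : ℝ} (ht : 0 ≤ t) :
    distMK2 (f t : Measure (Phase d)) (firstMarginal hN (F t)) ^ 2 ≤
      ENNReal.ofReal (2 * κ * d / (N * a) * (Real.exp (a * t) - 1)) := by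
  set M : ℝ → Mat d := fun s => meanU (f (max s 0)) with hMdef
  have hM : Continuous M := continuous_meanU hf.continuousOn
  have hM1 : ∀ s i k, ‖M s i k‖ ≤ 1 := fun s i k => norm_meanU_le _ i k
  obtain ⟨Φ, hΦ⟩ := exists_isFlow (Fin N) 0 (κ / (2 * N)) hM hM1
  obtain ⟨Ψ, hΨ⟩ := exists_isFlow Unit (κ / 2) 0 hM hM1
  set ρ : Measure (Phase d) := (f₀ : Measure (Phase d))
  set π : Measure (Fin N → Phase d) := Measure.pi fun _ : Fin N => ρ
  set j₀ : Fin N := ⟨0, hN⟩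
  have hft := fun s (hs : 0 ≤ s) => hf.map_single hΨ hs
  have hFt : (F t : Measure (Fin N → Phase d)) = π.map (Φ t) :=
    hΦ.map_eq_of_isWeakSolution hM hM1
      (IsWeakSolution.congr hF fun s z _ => (loheField_eq κ (M s) z).symm) ht
  have hsm : Measurable (single Ψ t) := (continuous_single hΨ ht).measurable
  have hmean : ∀ s, 0 ≤ s → M s = Matrix.of fun i j => ∫ w, ((single Ψ s w).1 : Mat d) i j ∂ρ := by
    intro s hs
    ext i j
    simp only [hMdef, meanU, max_eq_left hs, Matrix.of_apply]
    rw [hft s hs, integral_map (continuous_single hΨ hs).measurable.aemeasurable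
      (measurable_entry i j).aestronglyMeasurable]
  have hV : Measurable fun z : Fin N → Phase d => single Ψ t (z j₀) :=
    hsm.comp (measurable_pi_apply j₀)
  have hU : Measurable fun z : Fin N → Phase d => Φ t z j₀ :=
    (measurable_pi_apply j₀).comp (hΦ.continuous t ht).measurable
  set m : Measure (Phase d × Phase d) := π.map fun z => (single Ψ t (z j₀), Φ t z j₀)
  have hm : m ∈ couplings (f t : Measure (Phase d)) (firstMarginal hN (F t)) := by
    constructor
    · have h1 := (measurePreserving_eval (fun _ : Fin N => ρ) j₀).map_eq
      rw [Measure.map_map measurable_fst (hV.prodMk hU), hft t ht]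
      change _ = ρ.map (single Ψ t)
      rw [← h1, Measure.map_map hsm (measurable_pi_apply j₀)]
      rfl
    · rw [Measure.map_map measurable_snd (hV.prodMk hU), firstMarginal, hFt,
        Measure.map_map (measurable_pi_apply j₀) (hΦ.continuous t ht).measurable]
      rfl
  have hdist : Measurable fun p : Phase d × Phase d => ENNReal.ofReal (distSq p.1 p.2) := by
    have h1 : Continuous fun p : Phase d × Phase d => frobSq ((p.1.1 : Mat d) - (p.2.1 : Mat d)) :=
      continuous_frobSq.comp ((continuous_val_fst.comp continuous_fst).sub
        (continuous_val_fst.comp continuous_snd))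
    have h2 : Continuous fun p : Phase d × Phase d => frobSq ((p.1.2 : Mat d) - (p.2.2 : Mat d)) :=
      continuous_frobSq.comp
        ((continuous_subtype_val.comp (continuous_snd.comp continuous_fst)).sub
          (continuous_subtype_val.comp (continuous_snd.comp continuous_snd)))
    exact (h1.add h2).measurable.ennreal_ofReal
  have hcost : ∀ z : Fin N → Phase d,
      distSq (single Ψ t (z j₀)) (Φ t z j₀) = frobSq (deviation Φ Ψ t z j₀) := by
    intro z
    have e1 := (hΦ.isTrajectory z).snd_eq t j₀
    have e2 := (hΨ.isTrajectory fun _ => z j₀).snd_eq t ()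
    simp only [hΦ.zero] at e1
    simp only [hΨ.zero] at e2
    have e3 : (single Ψ t (z j₀)).2 = (z j₀).2 := e2
    have hneg : ∀ A B : Mat d, frobSq (A - B) = frobSq (B - A) := fun A B => by
      simp only [frobSq, Matrix.sub_apply, norm_sub_rev]
    rw [distSq, e1, e3, sub_self, hneg, deviation]
    simp [frobSq]
  have hsq : distMK2 (f t : Measure (Phase d)) (firstMarginal hN (F t)) ^ 2 =
      ⨅ m ∈ couplings (f t : Measure (Phase d)) (firstMarginal hN (F t)),
        ∫⁻ p, ENNReal.ofReal (distSq p.1 p.2) ∂m := by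
    rw [distMK2, ← ENNReal.rpow_natCast, ← ENNReal.rpow_mul]
    norm_num
  calc distMK2 (f t : Measure (Phase d)) (firstMarginal hN (F t)) ^ 2
      ≤ ∫⁻ p, ENNReal.ofReal (distSq p.1 p.2) ∂m := hsq ▸ iInf₂_le m hm
    _ = ∫⁻ z, ENNReal.ofReal (frobSq (deviation Φ Ψ t z j₀)) ∂π := by
        rw [lintegral_map hdist (hV.prodMk hU)]
        exact lintegral_congr fun z => congrArg ENNReal.ofReal (hcost z)
    _ = ENNReal.ofReal (∫ z, frobSq (deviation Φ Ψ t z j₀) ∂π) :=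
        (ofReal_integral_eq_lintegral_ofReal (integrable_frobSq_deviation hΦ hΨ π ht j₀)
          (Filter.Eventually.of_forall fun z => frobSq_nonneg _)).symm
    _ ≤ _ := by
        rw [integral_frobSq_deviation_eq hN hΦ hΨ ρ ht j₀]
        exact ENNReal.ofReal_le_ofReal
          (integral_meanSqDeviation_le hN hκ hM hM1 hΦ hΨ ρ hmean ha ha0 ht)

end

end Lohe

theorem theorem3p1 (d N : ℕ) (hN : 0 < N) (κ : ℝ) (hκ : 0 ≤ κ)
    (f₀ : ProbabilityMeasure (Lohe.Phase d)) (hf₀ : Lohe.HasFiniteSecondMoment f₀)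
    (f : ℝ → ProbabilityMeasure (Lohe.Phase d)) (hf : Lohe.IsKineticLoheSolution κ f₀ f)
    (F : ℝ → ProbabilityMeasure (Fin N → Lohe.Phase d))
    (hF : Lohe.IsLiouvilleSolution κ (ProbabilityMeasure.pi fun _ : Fin N => f₀) F)
    (t : ℝ) (ht : 0 ≤ t) :
    Lohe.distMK2 (f t : Measure (Lohe.Phase d)) (Lohe.firstMarginal hN (F t)) ^ 2 ≤
        ENNReal.ofReal (16 * κ * d / ((2 + 9 * κ) * N) *
          (Real.exp ((1 + 9 * κ / 2) * t) - 1)) ∧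
      (κ ≤ 2 →
        Lohe.distMK2 (f t : Measure (Lohe.Phase d)) (Lohe.firstMarginal hN (F t)) ^ 2 ≤
          ENNReal.ofReal (8 * d / (5 * N) * (Real.exp (10 * t) - 1))) := by
  have hN' : (0 : ℝ) < N := by exact_mod_cast hN
  constructor
  · refine (Lohe.distMK2_sq_le hN hκ hf hF (a := 1 + 9 * κ / 2) (by linarith) (by positivity)
      ht).trans (ENNReal.ofReal_le_ofReal ?_)
    refine mul_le_mul_of_nonneg_right ?_ (sub_nonneg.2 (Real.one_le_exp (by positivity)))
    have h : 2 * κ * d / (N * (1 + 9 * κ / 2)) = 4 * κ * d / ((2 + 9 * κ) * N) := by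
      field_simp
      ring
    rw [h]
    gcongr
    norm_num
  · intro hκ2
    refine (Lohe.distMK2_sq_le hN hκ hf hF (a := 10) (by linarith) (by norm_num) ht).trans
      (ENNReal.ofReal_le_ofReal ?_)
    refine mul_le_mul_of_nonneg_right ?_ (sub_nonneg.2 (Real.one_le_exp (by positivity)))
    rw [div_le_div_iff₀ (by positivity) (by positivity)]
    have : (d : ℝ) * κ ≤ d * 2 := by gcongr
    have h2 : 0 ≤ (d : ℝ) * N := by positivity
    have h3 : (d : ℝ) * κ * N ≤ d * 2 * N := by gcongr
    nlinarith
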